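/- **Definitions.** For $x=(x_0,\dots,x_{t-1})\in\{0,1\}^t$ and $i\in\mathbb Z$ let $x(i)$ be the cyclic shift with $r$-th bit $x_{(r+i)\bmod t}$, let $x^*=x(-1)\vee x\vee x(1)$ (the slipped vector), and for real $b\ge 0$ let $|x_{[0,b]}|$ be the number of ones of $x$ in positions $0\le r\le b$, $r<t$; $|x_{[b,b']}|$ is defined likewise for $b\le r\le b'$. Let $M$ be a $t\times n$ binary matrix with columns $[1],\dots,[n]$, let $0<\alpha\le1$, $\tau:\mathbb N\times\mathbb N\to[0,\infty)$ and $\Delta\le n$. $M$ is an $(n,\alpha)$-ultra-resilient superimposed code (URSC) of length $t$ with elongation $\tau$ for all $1\le k\le\Delta$ if for every $1\le k\le \Delta$, every set $T$ of $k$ column indices, every $j\in T$, and every $z=\bigvee_{m\in T\setminus\{j\}}[m](i_m)$ with arbitrary shifts $i_m$, $$\bigl|([j]\wedge z^*)_{[0,\tau(n,k)]}\bigr|<\alpha\,\bigl|[j]_{[0,\tau(n,k)]}\bigr| .$$ **Algorithm.** The input is $n\ge2$, a length $t\ge 0$, $0<\alpha\le1$, $\varepsilon>0$, $c>0$. Put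 $a=\alpha/2$, $b=c/2^{2+\varepsilon}$, $\tau_1(n,k)=\frac b{64}k^2\ln n$, $\tau(n,k)=b\frac{k^2}{a^{2+\varepsilon}}\ln n=c\frac{k^2}{\alpha^{2+\varepsilon}}\ln n$, and let $\Delta$ be the largest integer with $\Delta\le n$ and $\tau(n,\Delta)\le t$. Repeat: generate a random $t\times n$ binary matrix whose entries are independent, those of row $r$ ($0\le r<t$) being $1$ with probability $\bigl(\lfloor r/\ln n\rfloor+1\bigr)^{-1/2}$; until the following check succeeds: for all $1<k\le\Delta$, all $j\ne j'$ and all $0\le i<t$, $$|[j]_{[0,\tau_1(n,k)]}|\le a\,w\quad\text{and}\quad \bigl|\bigl([j]\wedge [j'](i)^*\bigr)_{[\tau_1(n,k),\tau(n,k)]}\bigr|\le\Bigl\lfloor\frac{a\,w-1}{k-1}\Bigr\rfloor,\qquad w=|[j]_{[\tau_1(n,k),\tau(n,k)]}| .$$ Then return the last matrix. The running time is the number of elementary operations (arithmetic operations on natural and real numbers including $\ln$, square roots, powers and floors, comparisons, array accesses, assignments, loop steps, and independent coin tosses of given bias), each of unit cost, of a straightforward implementation by nested loops. **Theorem.** There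 is an absolute constant $K$ such that for every $\varepsilon>0$ there is $c_0=c_0(\varepsilon)>0$ such that for all $c\ge c_0$, all integers $n\ge2$, $t\ge0$ and all $0<\alpha\le1$, with $$\tau(n,k)=c\,\frac{k^2}{\alpha^{2+\varepsilon}}\ln n=O\Bigl(\frac{k^2}{\alpha^{2+\varepsilon}}\log n\Bigr)$$ and $\Delta$ the largest integer with $\Delta\le n$ and $\tau(n,\Delta)\le t$: 1. whenever the algorithm halts, the returned matrix is an $(n,\alpha)$-URSC of length $t$ with elongation $\tau$ for all $1\le k\le\Delta$; 2. the algorithm halts in polynomial time with high probability: with $B=K n^3(t+1)^2$, its running time (defined as $\infty$ if it does not halt) exceeds $mB$ with probability at most $n^{-2m}$, for every integer $m\ge0$ (in particular it is at most $B$ with probability at least $1-n^{-2}$); 3. its expected running time is at most $B$. -/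

import Mathlib

open MeasureTheory
open scoped ENNReal

/-! ### Binary vectors, cyclic shifts and ultra-resilient superimposed codes -/

/-- The `i`-th cyclic shift of the binary vector `x = (x_0, …, x_{t-1})`:
its `r`-th bit is `x_{(r + i) mod t}`. -/
def cyclicShift {t : ℕ} (i : ℕ) (x : Fin t → Bool) : Fin t → Bool :=
  fun r => x ⟨((r : ℕ) + i) % t, Nat.mod_lt _ (Nat.zero_lt_of_lt r.isLt)⟩

/-- The set `S(x)` of all cyclic shifts of `x`. -/
def cyclicShifts {t : ℕ} (x : Fin t → Bool) : Set (Fin t → Bool) :=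
  {y | ∃ i : ℕ, y = cyclicShift i x}

/-- The slipped vector `z* = z(-1) ∨ z ∨ z(1)`. Shifts are taken modulo the length `t`,
so the shift by `-1` is the shift by `t - 1`. -/
def slipped {t : ℕ} (z : Fin t → Bool) : Fin t → Bool :=
  cyclicShift (t - 1) z ⊔ z ⊔ cyclicShift 1 z

/-- `S_∨(R)` for the family `R` of the columns of `M` with index in `R`: all bitwise ORs of one
cyclic shift of each of these columns. -/
def orShifts {t n : ℕ} (M : Matrix (Fin t) (Fin n) Bool) (R : Finset (Fin n)) :
    Set (Fin t → Bool) :=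
  {z | ∃ y : Fin n → (Fin t → Bool), (∀ i ∈ R, y i ∈ cyclicShifts (M.col i)) ∧ z = R.sup y}

/-- The weight `|x_{[0, b]}|`: the number of ones of `x` in the positions `0, 1, …, ⌊b⌋`. -/
noncomputable def weightUpTo {t : ℕ} (x : Fin t → Bool) (b : ℝ) : ℕ :=
  Set.ncard {r : Fin t | ((r : ℕ) : ℝ) ≤ b ∧ x r = true}

/-- The `t × n` binary matrix `M` is an `(n, α)`-ultra-resilient superimposed code of length `t`
with elongation `τ`, with the guarantee for all `1 ≤ k ≤ Δ`. -/
def IsURSC {t n : ℕ} (M : Matrix (Fin t) (Fin n) Bool) (α : ℝ) (τ : ℕ → ℕ → ℝ) (Δ : ℕ) : Prop :=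
  ∀ k : ℕ, 1 ≤ k → k ≤ Δ → ∀ T : Finset (Fin n), T.card = k → ∀ j ∈ T,
    ∀ z ∈ orShifts M (T.erase j),
      (weightUpTo (M.col j ⊓ slipped z) (τ n k) : ℝ) < α * (weightUpTo (M.col j) (τ n k) : ℝ)

/-- The elongation function `τ(n, k) = c (k² / α^(2+ε)) ln n`. -/
noncomputable def elongation (c α ε : ℝ) (n k : ℕ) : ℝ :=
  c * ((k : ℝ) ^ 2 / α ^ (2 + ε)) * Real.log n

/-! ### A randomized random access machine with unit-cost operations

Programs work on registers holding natural numbers, registers holding real numbers, and a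
two-dimensional array of bits. Every arithmetic operation, comparison, array access, assignment,
loop step and biased coin toss is charged. -/

namespace RAM

/-- Expressions with a natural number as value. -/
inductive NatExp : Type
  | lit (m : ℕ)
  | reg (x : ℕ)
  | add (e f : NatExp)
  | sub (e f : NatExp)
  | mod (e f : NatExp)

/-- Expressions with a real number as value. -/
inductive RealExp : Type
  | ofNat (e : NatExp)
  | reg (x : ℕ)
  | add (e f : RealExp)
  | sub (e f : RealExp)
  | mul (e f : RealExp)
  | div (e f : RealExp)
  | rpow (e f : RealExp)
  | sqrt (e : RealExp)
  | log (e : RealExp)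
  | floor (e : RealExp)

/-- Tests. -/
inductive Test : Type
  | natLt (e f : NatExp)
  | natEq (e f : NatExp)
  | realLe (e f : RealExp)
  | bit (row col : NatExp)
  | neg (b : Test)
  | and (b d : Test)
  | or (b d : Test)

/-- Commands: assignments, setting a bit of the array by a biased coin, sequencing, conditionals,
and bounded loops `for x = 0, …, e - 1 do body`. -/
inductive Cmd : Type
  | setNat (x : ℕ) (e : NatExp)
  | setReal (x : ℕ) (e : RealExp)
  | toss (row col : NatExp) (p : RealExp)
  | seq (a b : Cmd)
  | ifThen (b : Test) (a : Cmd)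
  | forLoop (x : ℕ) (e : NatExp) (body : Cmd)

/-- A state of the machine: the registers, the array, the number `pos` of coins tossed so far and
the number `time` of elementary operations executed so far. -/
structure State : Type where
  nat : ℕ → ℕ
  real : ℕ → ℝ
  bit : ℕ → ℕ → Bool
  pos : ℕ
  time : ℕ

/-- Charge `m` elementary operations. -/
def State.charge (s : State) (m : ℕ) : State := { s with time := s.time + m }

def NatExp.eval (s : State) : NatExp → ℕ
  | lit m => m
  | reg x => s.nat x
  | add e f => e.eval s + f.eval s
  | sub e f => e.eval s - f.eval s
  | mod e f => e.eval s % f.eval s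

/-- The number of elementary operations in the evaluation of an expression. -/
def NatExp.cost : NatExp → ℕ
  | lit _ => 1
  | reg _ => 1
  | add e f => e.cost + f.cost + 1
  | sub e f => e.cost + f.cost + 1
  | mod e f => e.cost + f.cost + 1

noncomputable def RealExp.eval (s : State) : RealExp → ℝ
  | ofNat e => (e.eval s : ℝ)
  | reg x => s.real x
  | add e f => e.eval s + f.eval s
  | sub e f => e.eval s - f.eval s
  | mul e f => e.eval s * f.eval s
  | div e f => e.eval s / f.eval s
  | rpow e f => (e.eval s) ^ (f.eval s)
  | sqrt e => Real.sqrt (e.eval s)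
  | log e => Real.log (e.eval s)
  | floor e => ((⌊e.eval s⌋ : ℤ) : ℝ)

def RealExp.cost : RealExp → ℕ
  | ofNat e => e.cost + 1
  | reg _ => 1
  | add e f => e.cost + f.cost + 1
  | sub e f => e.cost + f.cost + 1
  | mul e f => e.cost + f.cost + 1
  | div e f => e.cost + f.cost + 1
  | rpow e f => e.cost + f.cost + 1
  | sqrt e => e.cost + 1
  | log e => e.cost + 1
  | floor e => e.cost + 1

def Test.eval (s : State) : Test → Prop
  | natLt e f => e.eval s < f.eval s
  | natEq e f => e.eval s = f.eval s
  | realLe e f => e.eval s ≤ f.eval s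
  | bit row col => s.bit (row.eval s) (col.eval s) = true
  | neg b => ¬ b.eval s
  | and b d => b.eval s ∧ d.eval s
  | or b d => b.eval s ∨ d.eval s

def Test.cost : Test → ℕ
  | natLt e f => e.cost + f.cost + 1
  | natEq e f => e.cost + f.cost + 1
  | realLe e f => e.cost + f.cost + 1
  | bit row col => row.cost + col.cost + 1
  | neg b => b.cost + 1
  | and b d => b.cost + d.cost + 1
  | or b d => b.cost + d.cost + 1

open Classical in
/-- Execution of a command. The randomness is a sequence `ω` of numbers in `[0, 1]` (independent and
uniform under `coins` below); the next coin with bias `p` shows `1` iff the next unused number of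
the sequence is at most `p`. -/
noncomputable def Cmd.exec (ω : ℕ → unitInterval) : Cmd → State → State
  | setNat x e, s =>
      ({ s with nat := Function.update s.nat x (e.eval s) } : State).charge (e.cost + 1)
  | setReal x e, s =>
      ({ s with real := Function.update s.real x (e.eval s) } : State).charge (e.cost + 1)
  | toss row col p, s =>
      ({ s with
          bit := Function.update s.bit (row.eval s)
            (Function.update (s.bit (row.eval s)) (col.eval s)
              (decide ((ω s.pos : ℝ) ≤ p.eval s)))
          pos := s.pos + 1 } : State).charge (row.cost + col.cost + p.cost + 1)
  | seq a b, s => b.exec ω (a.exec ω s)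
  | ifThen b a, s =>
      if b.eval s then a.exec ω (s.charge (b.cost + 1)) else s.charge (b.cost + 1)
  | forLoop x e body, s =>
      (List.range (e.eval s)).foldl
        (fun s i => body.exec ω
          (({ s with nat := Function.update s.nat x i } : State).charge 1))
        (s.charge (e.cost + 1))

/-- A program of the form `setup; repeat body until halt`. -/
structure Program : Type where
  setup : Cmd
  body : Cmd
  halt : Test

/-- The state after `setup` and `m` rounds of the `repeat` loop. -/
noncomputable def Program.after (P : Program) (ω : ℕ → unitInterval) (s : State) : ℕ → State
  | 0 => P.setup.exec ω s
  | m + 1 => (P.body.exec ω (P.after ω s m)).charge (P.halt.cost + 1)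

open Classical in
/-- The state in which `P`, started in `s`, halts: the one after the first round (there is at least
one) at the end of which the test `halt` holds, and `none` if there is no such round. -/
noncomputable def Program.result (P : Program) (ω : ℕ → unitInterval) (s : State) : Option State :=
  if h : ∃ m : ℕ, P.halt.eval (P.after ω s (m + 1)) then
    some (P.after ω s (Nat.find h + 1))
  else none

/-- The number of elementary operations that `P`, started in `s`, executes until it halts
(`∞` if it does not halt). -/
noncomputable def Program.runTime (P : Program) (ω : ℕ → unitInterval) (s : State) : ℝ≥0∞ :=
  match P.result ω s with
  | some s' => (s'.time : ℝ≥0∞)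
  | none => ⊤

/-- The law of the randomness: independent uniformly distributed numbers in `[0, 1]`. -/
noncomputable def coins : Measure (ℕ → unitInterval) :=
  Measure.infinitePi (fun _ : ℕ => (volume : Measure unitInterval))

end RAM

/-! ### The algorithm -/

namespace CodeAlg

open RAM

/-! Registers for natural numbers: the inputs `n` and `t`, the parameter `Δ`, the loop variables
`k`, `j`, `j'`, `i`, `r`, the weights of the upper and the lower segment of a column, the collision
weight, and the outcome `ok` of the check. -/

abbrev vN : NatExp := .reg 0
abbrev vT : NatExp := .reg 1
abbrev vDelta : NatExp := .reg 2
abbrev vK : NatExp := .reg 3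
abbrev vJ : NatExp := .reg 4
abbrev vJ2 : NatExp := .reg 5
abbrev vI : NatExp := .reg 6
abbrev vR : NatExp := .reg 7
abbrev vUpper : NatExp := .reg 8
abbrev vLower : NatExp := .reg 9
abbrev vColl : NatExp := .reg 10
abbrev vOk : NatExp := .reg 11

/-! Registers for real numbers: the inputs `α`, `ε`, `c`, then `a = α/2`, `b = c/2^(2+ε)`, and
the values `τ₁ = (b/64) k² ln n` and `τ₂ = b (k²/a^(2+ε)) ln n` for the current `k`. -/

abbrev vAlpha : RealExp := .reg 0
abbrev vEps : RealExp := .reg 1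
abbrev vC : RealExp := .reg 2
abbrev vA : RealExp := .reg 3
abbrev vB : RealExp := .reg 4
abbrev vTau1 : RealExp := .reg 5
abbrev vTau2 : RealExp := .reg 6

abbrev num (m : ℕ) : RealExp := .ofNat (.lit m)
abbrev lnN : RealExp := .log (.ofNat vN)
abbrev kSq : RealExp := .mul (.ofNat vK) (.ofNat vK)

/-- `τ₁ := (b/64) k² ln n; τ₂ := b (k²/a^(2+ε)) ln n` -/
def setTaus : Cmd :=
  .seq (.setReal 5 (.mul (.mul (.div vB (num 64)) kSq) lnN))
    (.setReal 6 (.mul (.mul vB (.div kSq (.rpow vA (.add (num 2) vEps)))) lnN))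

/-- `a := α/2; b := c/2^(2+ε); Δ := 0;` and then `Δ := k` for all `1 ≤ k ≤ n` with `τ₂ ≤ t`. -/
def setupCmd : Cmd :=
  .seq (.setReal 3 (.div vAlpha (num 2)))
  (.seq (.setReal 4 (.div vC (.rpow (num 2) (.add (num 2) vEps))))
  (.seq (.setNat 2 (.lit 0))
  (.forLoop 3 (.add vN (.lit 1))
    (.ifThen (.natLt (.lit 0) vK)
      (.seq setTaus
      (.ifThen (.realLe vTau2 (.ofNat vT)) (.setNat 2 vK)))))))

/-- Generate the random matrix: the `r`-th bit of each column is set to `1` with probability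
`√(1 / (⌊r / ln n⌋ + 1))`, independently of all the others. -/
def generate : Cmd :=
  .forLoop 7 vT (.forLoop 4 vN
    (.toss vR vJ (.sqrt (.div (num 1) (.add (.floor (.div (.ofNat vR) lnN)) (num 1))))))

/-- Compute the weights of the segments `[0, τ₁]` and `[τ₁, τ₂]` of column `j`, and the number of
positions in `[τ₁, τ₂]` in which column `j` and the slipped vector of the `i`-th cyclic shift of
column `j'` both have a `1`. -/
def countWeights : Cmd :=
  .seq (.setNat 8 (.lit 0)) (.seq (.setNat 9 (.lit 0)) (.seq (.setNat 10 (.lit 0))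
  (.forLoop 7 vT
    (.ifThen (.bit vR vJ)
      (.seq
        (.ifThen (.realLe (.ofNat vR) vTau1) (.setNat 8 (.add vUpper (.lit 1))))
        (.ifThen (.and (.realLe vTau1 (.ofNat vR)) (.realLe (.ofNat vR) vTau2))
          (.seq (.setNat 9 (.add vLower (.lit 1)))
          (.ifThen
            (.or
              (.or (.bit (.mod (.add (.add vR vI) (.sub vT (.lit 1))) vT) vJ2)
                (.bit (.mod (.add vR vI) vT) vJ2))
              (.bit (.mod (.add (.add vR vI) (.lit 1)) vT) vJ2))
            (.setNat 10 (.add vColl (.lit 1)))))))))))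

/-- The Weight Inequality `upper ≤ a · lower`. -/
def weightTest : Test :=
  .realLe (.ofNat vUpper) (.mul vA (.ofNat vLower))

/-- The Collision Weight Inequality `collisions ≤ ⌊(a · lower - 1) / (k - 1)⌋`. -/
def collisionTest : Test :=
  .realLe (.ofNat vColl)
    (.floor (.div (.sub (.mul vA (.ofNat vLower)) (num 1)) (.sub (.ofNat vK) (num 1))))

/-- Check the Collision Bound Property for all `1 < k ≤ Δ`: set `ok` to `1` iff both inequalities
hold for every such `k`, each pair of columns `j ≠ j'` and every cyclic shift of column `j'`. -/
def check : Cmd :=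
  .seq (.setNat 11 (.lit 1))
  (.forLoop 3 (.add vDelta (.lit 1))
    (.ifThen (.natLt (.lit 1) vK)
      (.seq setTaus
      (.forLoop 4 vN (.forLoop 5 vN
        (.ifThen (.neg (.natEq vJ vJ2))
          (.forLoop 6 vT
            (.seq countWeights
            (.ifThen (.neg (.and weightTest collisionTest)) (.setNat 11 (.lit 0)))))))))))

/-- The algorithm: generate random `t × n` matrices until one of them passes the check. -/
def algorithm : Program where
  setup := setupCmd
  body := .seq generate check
  halt := .natEq vOk (.lit 1)

/-- The initial state: the inputs are in their registers, everything else is `0`. -/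
def start (n t : ℕ) (α ε c : ℝ) : State where
  nat := fun x => if x = 0 then n else if x = 1 then t else 0
  real := fun x => if x = 0 then α else if x = 1 then ε else if x = 2 then c else 0
  bit := fun _ _ => false
  pos := 0
  time := 0

/-- The `t × n` matrix stored in the array. -/
def outputMatrix (t n : ℕ) (s : State) : Matrix (Fin t) (Fin n) Bool :=
  Matrix.of fun r j => s.bit r j

end CodeAlg

/-! The correctness part is deterministic. Fix `k ≥ 2` and a column `j`, and let `w` be its weight
in `[τ₁, τ₂]`. The check bounds the ones of column `j` up to `τ₁` by `a w`, and its collisions with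
each of the other `k - 1` slipped columns by `(a w - 1)/(k - 1)`. Altogether at most `2 a w - 1 < α
w` ones are covered (`isURSC_of_passes`). For `k = 1` nothing is covered, and row `0` consists of
ones because its bias is `1`.

For the running time it suffices that a round fails with probability at most `n⁻²`
(`real_not_roundPasses_le`). Write `L = ln n`, `β = √b`, `A = 1/a`, `u = A^(ε/2)`; then `τ₁ =
(βk/8)² L` and `τ₂ = (βkAu)² L`. Row `r` has bias about `√(L/r)`, so a column has expected weight
about `2√(Lx)` up to position `x`. This is `βkL/4` up to `τ₁` and of order `βkAuL` up to `τ₂`, and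
Chernoff's bound gives the weight inequality. Two columns collide in `[τ₁, τ₂]` about `∑ L/r ≈ L
ln(τ₂/τ₁) = 2L ln(8Au)` times. Since `ln A ≤ (2/ε) A^(ε/2)`, this is `O_ε(Lu)`, whereas about `βLu`
collisions are allowed; a large `β` therefore suffices. The extra factor `α^(-ε)` in `τ` pays for
the logarithm.

The length `t` is not bounded in terms of `n`, so a plain union bound over the `t` shifts fails. A
shift by `e ≥ τ₂` that does not wrap around inside the window moves it to rows of bias at most
`√(L/e)`. The expectation drops by the factor `√(τ₂/e)`, and a suitably tilted Chernoff bound gains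
`(τ₂/e)²`. The resulting sum over all shifts is `O(τ₂)` (`sum_shifts_le`, `sum_collision_tail_le`).

Rounds use disjoint blocks of coins, so `m` rounds all fail with probability at most `n^(-2m)`
(`coins_forall_not_roundPasses_le`). Together with a worst-case cost per round this gives the tail
bound, and a geometric series gives the expectation. -/

namespace RAM

/-! ### Reasoning rules for the machine: loop invariants, unchanged registers, cost bounds. -/

theorem foldl_range_induction {σ : Type*} (f : σ → ℕ → σ) (Inv : ℕ → σ → Prop) (N : ℕ) (s : σ)
    (h0 : Inv 0 s) (hs : ∀ i < N, ∀ s, Inv i s → Inv (i + 1) (f s i)) :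
    Inv N ((List.range N).foldl f s) := by
  induction N with
  | zero => simpa using h0
  | succ N ih =>
    rw [List.range_succ, List.foldl_append]
    exact hs N (Nat.lt_succ_self N) _ (ih fun i hi => hs i (hi.trans (Nat.lt_succ_self N)))

/-- The loop rule: an invariant that is kept by every pass of a `for` loop holds at its end. -/
theorem Cmd.exec_forLoop_induction {ω : ℕ → unitInterval} {x : ℕ} {e : NatExp} {body : Cmd}
    {s : State} (Inv : ℕ → State → Prop) (h0 : Inv 0 (s.charge (e.cost + 1)))
    (hs : ∀ i < e.eval s, ∀ s', Inv i s' → Inv (i + 1) (body.exec ω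
      (({ s' with nat := Function.update s'.nat x i } : State).charge 1))) :
    Inv (e.eval s) ((Cmd.forLoop x e body).exec ω s) :=
  foldl_range_induction _ Inv _ _ h0 hs

/-- The registers for natural numbers that a command may write. -/
def Cmd.natWrites : Cmd → List ℕ
  | setNat x _ => [x]
  | setReal _ _ => []
  | toss _ _ _ => []
  | seq a b => a.natWrites ++ b.natWrites
  | ifThen _ a => a.natWrites
  | forLoop x _ body => x :: body.natWrites

/-- The registers for real numbers that a command may write. -/
def Cmd.realWrites : Cmd → List ℕ
  | setNat _ _ => []
  | setReal x _ => [x]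
  | toss _ _ _ => []
  | seq a b => a.realWrites ++ b.realWrites
  | ifThen _ a => a.realWrites
  | forLoop _ _ body => body.realWrites

/-- Whether a command contains a coin toss. -/
def Cmd.tosses : Cmd → Bool
  | setNat _ _ => false
  | setReal _ _ => false
  | toss _ _ _ => true
  | seq a b => a.tosses || b.tosses
  | ifThen _ a => a.tosses
  | forLoop _ _ body => body.tosses

@[simp] theorem State.charge_nat (s : State) (m : ℕ) : (s.charge m).nat = s.nat := rfl
@[simp] theorem State.charge_real (s : State) (m : ℕ) : (s.charge m).real = s.real := rfl
@[simp] theorem State.charge_bit (s : State) (m : ℕ) : (s.charge m).bit = s.bit := rfl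
@[simp] theorem State.charge_pos (s : State) (m : ℕ) : (s.charge m).pos = s.pos := rfl
@[simp] theorem State.charge_time (s : State) (m : ℕ) : (s.charge m).time = s.time + m := rfl

variable {ω : ℕ → unitInterval}

/-- Frame rule. The list `natWrites` is computable, so for concrete programs the hypothesis is
closed by `decide`. -/
theorem Cmd.exec_nat {c : Cmd} {x : ℕ} (h : x ∉ c.natWrites) (s : State) :
    (c.exec ω s).nat x = s.nat x := by
  induction c generalizing s with
  | setNat y e =>
    have : x ≠ y := by simpa [natWrites] using h
    simp [exec, Function.update_of_ne this]
  | setReal y e => simp [exec]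
  | toss r j p => simp [exec]
  | seq a b iha ihb =>
    simp only [natWrites, List.mem_append, not_or] at h
    simp only [exec]
    rw [ihb h.2, iha h.1]
  | ifThen b a ih =>
    simp only [exec]
    split_ifs
    · rw [ih h]; simp
    · simp
  | forLoop y e body ih =>
    simp only [natWrites, List.mem_cons, not_or] at h
    refine Cmd.exec_forLoop_induction (fun _ s' => s'.nat x = s.nat x) rfl fun i _ s' hs' => ?_
    rw [ih h.2]
    simpa [Function.update_of_ne h.1] using hs'

theorem Cmd.exec_real {c : Cmd} {x : ℕ} (h : x ∉ c.realWrites) (s : State) :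
    (c.exec ω s).real x = s.real x := by
  induction c generalizing s with
  | setNat y e => simp [exec]
  | setReal y e =>
    have : x ≠ y := by simpa [realWrites] using h
    simp [exec, Function.update_of_ne this]
  | toss r j p => simp [exec]
  | seq a b iha ihb =>
    simp only [realWrites, List.mem_append, not_or] at h
    simp only [exec]
    rw [ihb h.2, iha h.1]
  | ifThen b a ih =>
    simp only [exec]
    split_ifs
    · rw [ih h]; simp
    · simp
  | forLoop y e body ih =>
    refine Cmd.exec_forLoop_induction (fun _ s' => s'.real x = s.real x) rfl fun i _ s' hs' => ?_
    rw [ih h]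
    simpa using hs'

theorem Cmd.exec_bit_pos {c : Cmd} (h : c.tosses = false) (s : State) :
    (c.exec ω s).bit = s.bit ∧ (c.exec ω s).pos = s.pos := by
  induction c generalizing s with
  | setNat y e => simp [exec]
  | setReal y e => simp [exec]
  | toss r j p => simp [tosses] at h
  | seq a b iha ihb =>
    simp only [tosses, Bool.or_eq_false_iff] at h
    simp only [exec]
    rw [(ihb h.2 _).1, (ihb h.2 _).2]
    exact iha h.1 s
  | ifThen b a ih =>
    simp only [exec]
    split_ifs
    · simpa using ih h (s.charge (b.cost + 1))
    · simp
  | forLoop y e body ih =>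
    refine Cmd.exec_forLoop_induction (fun _ s' => s'.bit = s.bit ∧ s'.pos = s.pos) ⟨rfl, rfl⟩
      fun i _ s' hs' => ?_
    rw [(ih h _).1, (ih h _).2]
    simpa using hs'.imp id id

/-- The registers that occur in an expression. -/
def NatExp.regs : NatExp → List ℕ
  | lit _ => []
  | reg x => [x]
  | add e f => e.regs ++ f.regs
  | sub e f => e.regs ++ f.regs
  | mod e f => e.regs ++ f.regs

/-- The value of an expression under an assignment of values to the registers. -/
def NatExp.value (v : ℕ → ℕ) : NatExp → ℕ
  | lit m => m
  | reg x => v x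
  | add e f => e.value v + f.value v
  | sub e f => e.value v - f.value v
  | mod e f => e.value v % f.value v

theorem NatExp.eval_eq_value {e : NatExp} {s : State} {v : ℕ → ℕ}
    (h : ∀ x ∈ e.regs, s.nat x = v x) : e.eval s = e.value v := by
  induction e with
  | lit m => rfl
  | reg x => exact h x (by simp [regs])
  | add e f ihe ihf =>
    simp only [regs, List.mem_append] at h
    simp only [eval, value, ihe fun x hx => h x (.inl hx), ihf fun x hx => h x (.inr hx)]
  | sub e f ihe ihf =>
    simp only [regs, List.mem_append] at h
    simp only [eval, value, ihe fun x hx => h x (.inl hx), ihf fun x hx => h x (.inr hx)]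
  | mod e f ihe ihf =>
    simp only [regs, List.mem_append] at h
    simp only [eval, value, ihe fun x hx => h x (.inl hx), ihf fun x hx => h x (.inr hx)]

/-- The registers that occur in the bounds of the loops of a command. -/
def Cmd.boundRegs : Cmd → List ℕ
  | setNat _ _ => []
  | setReal _ _ => []
  | toss _ _ _ => []
  | seq a b => a.boundRegs ++ b.boundRegs
  | ifThen _ a => a.boundRegs
  | forLoop _ e body => e.regs ++ body.boundRegs

/-- A bound for the running time of a command, given the values of the registers that occur in the
bounds of its loops. -/
def Cmd.costBound (v : ℕ → ℕ) : Cmd → ℕ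
  | setNat _ e => e.cost + 1
  | setReal _ e => e.cost + 1
  | toss row col p => row.cost + col.cost + p.cost + 1
  | seq a b => a.costBound v + b.costBound v
  | ifThen b a => b.cost + 1 + a.costBound v
  | forLoop _ e body => e.cost + 1 + e.value v * (1 + body.costBound v)

/-- The registers in `P` are never written, so every loop bound keeps its initial value and the cost
can be read off the syntax; a conditional is charged as if its branch were taken. The list `P` stays
fixed in the induction while the command shrinks. -/
theorem Cmd.exec_time_le {c : Cmd} {v : ℕ → ℕ} {P : List ℕ} (hP : ∀ x ∈ c.boundRegs, x ∈ P)
    (hw : ∀ x ∈ P, x ∉ c.natWrites) (s : State) (hs : ∀ x ∈ P, s.nat x = v x) :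
    (c.exec ω s).time ≤ s.time + c.costBound v := by
  induction c generalizing s with
  | setNat y e => simp [exec, costBound]
  | setReal y e => simp [exec, costBound]
  | toss r j p => simp [exec, costBound]
  | seq a b iha ihb =>
    simp only [boundRegs, natWrites, List.mem_append, not_or] at hP hw
    simp only [exec, costBound]
    have h1 := iha (fun x hx => hP x (.inl hx)) (fun x hx => (hw x hx).1) s hs
    have h2 := ihb (fun x hx => hP x (.inr hx)) (fun x hx => (hw x hx).2) (a.exec ω s)
      fun x hx => by rw [exec_nat (hw x hx).1, hs x hx]
    omega
  | ifThen b a ih =>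
    simp only [exec, costBound]
    split_ifs
    · have := ih hP hw (s.charge (b.cost + 1)) hs
      simp only [State.charge_time] at this
      omega
    · simp only [State.charge_time]
      omega
  | forLoop y e body ih =>
    simp only [boundRegs, natWrites, List.mem_append, List.mem_cons, not_or] at hP hw
    have hv : e.value v = e.eval s :=
      (NatExp.eval_eq_value fun x hx => hs x (hP x (.inl hx))).symm
    simp only [costBound, hv]
    refine (Cmd.exec_forLoop_induction (fun i s' => (∀ x ∈ P, s'.nat x = v x) ∧
      s'.time ≤ s.time + (e.cost + 1 + i * (1 + body.costBound v))) ⟨hs, by simp⟩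
      fun i _ s' hs' => ⟨fun x hx => ?_, ?_⟩).2
    · rw [exec_nat (hw x hx).2]
      simpa [Function.update_of_ne (hw x hx).1] using hs'.1 x hx
    · have := ih (fun x hx => hP x (.inr hx)) (fun x hx => (hw x hx).2)
        (({ s' with nat := Function.update s'.nat y i } : State).charge 1)
        fun x hx => by simpa [Function.update_of_ne (hw x hx).1] using hs'.1 x hx
      simp only [State.charge_time] at this
      have := hs'.2
      rw [add_mul]
      omega

/-- A loop without coin tosses whose passes clear the register `y`, unless it is `1` and a
condition `Q i` holds. -/
theorem Cmd.exec_forLoop_flag {x y : ℕ} {e : NatExp} {body : Cmd} {s : State}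
    (Q : ℕ → Prop) (hxy : y ≠ x) (ht : body.tosses = false)
    (hs : ∀ i < e.eval s, ∀ s' : State, (∀ z ∉ x :: body.natWrites, s'.nat z = s.nat z) →
      (∀ z ∉ body.realWrites, s'.real z = s.real z) → s'.bit = s.bit → s'.nat x = i →
      ((body.exec ω s').nat y = 1 ↔ s'.nat y = 1 ∧ Q i)) :
    ((forLoop x e body).exec ω s).nat y = 1 ↔ s.nat y = 1 ∧ ∀ i < e.eval s, Q i := by
  refine (Cmd.exec_forLoop_induction (fun N s' => ((∀ z ∉ x :: body.natWrites,
    s'.nat z = s.nat z) ∧ (∀ z ∉ body.realWrites, s'.real z = s.real z) ∧ s'.bit = s.bit) ∧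
    (s'.nat y = 1 ↔ s.nat y = 1 ∧ ∀ i < N, Q i)) ⟨by simp, by simp⟩ ?_).2
  rintro i hi s' ⟨⟨h1, h2, h3⟩, h4⟩
  have h1' : ∀ z ∉ x :: body.natWrites, (({ s' with nat := Function.update s'.nat x i } :
      State).charge 1).nat z = s.nat z := fun z hz => by
    have : z ≠ x := fun h => hz (by simp [h])
    simpa [Function.update_of_ne this] using h1 z hz
  refine ⟨⟨fun z hz => ?_, fun z hz => ?_, ?_⟩, ?_⟩
  · rw [exec_nat (fun h => hz (by simp [h])), h1' z hz]
  · rw [exec_real hz]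
    exact h2 z hz
  · rw [(exec_bit_pos ht _).1]
    exact h3
  · rw [hs i hi _ h1' h2 h3 (by simp), Nat.forall_lt_succ_right, ← and_assoc, ← h4]
    simp [Function.update_of_ne hxy]

end RAM

/-! ### What the subprograms of the algorithm compute. -/

namespace CodeAlg
open RAM

section Counts

open Classical in
/-- The weight of the part of column `j` in the positions up to `τ₁`. -/
noncomputable def upperCount (B : ℕ → ℕ → Bool) (τ₁ : ℝ) (j N : ℕ) : ℕ :=
  ((Finset.range N).filter fun r => B r j = true ∧ (r : ℝ) ≤ τ₁).card

open Classical in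
/-- The weight of the part of column `j` in the positions from `τ₁` to `τ₂`. -/
noncomputable def lowerCount (B : ℕ → ℕ → Bool) (τ₁ τ₂ : ℝ) (j N : ℕ) : ℕ :=
  ((Finset.range N).filter fun r => B r j = true ∧ (τ₁ ≤ r ∧ (r : ℝ) ≤ τ₂)).card

/-- Position `r` of the slipped vector of the `i`-th shift of column `j'` is set. -/
def SlipBit (B : ℕ → ℕ → Bool) (t j' i r : ℕ) : Prop :=
  (B ((r + i + (t - 1)) % t) j' = true ∨ B ((r + i) % t) j' = true) ∨
    B ((r + i + 1) % t) j' = true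

open Classical in
/-- The number of common ones of column `j` and the slipped `i`-th shift of column `j'` in the
positions from `τ₁` to `τ₂`. -/
noncomputable def collCount (B : ℕ → ℕ → Bool) (t : ℕ) (τ₁ τ₂ : ℝ) (j j' i N : ℕ) : ℕ :=
  ((Finset.range N).filter fun r =>
    B r j = true ∧ (τ₁ ≤ r ∧ (r : ℝ) ≤ τ₂) ∧ SlipBit B t j' i r).card

open Classical in
theorem upperCount_succ (B : ℕ → ℕ → Bool) (τ₁ : ℝ) (j N : ℕ) :
    upperCount B τ₁ j (N + 1) =
      upperCount B τ₁ j N + if B N j = true ∧ (N : ℝ) ≤ τ₁ then 1 else 0 :=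
  by rw [upperCount, upperCount, Finset.card_filter, Finset.card_filter, Finset.sum_range_succ]

open Classical in
theorem lowerCount_succ (B : ℕ → ℕ → Bool) (τ₁ τ₂ : ℝ) (j N : ℕ) :
    lowerCount B τ₁ τ₂ j (N + 1) = lowerCount B τ₁ τ₂ j N +
      if B N j = true ∧ (τ₁ ≤ N ∧ (N : ℝ) ≤ τ₂) then 1 else 0 :=
  by rw [lowerCount, lowerCount, Finset.card_filter, Finset.card_filter, Finset.sum_range_succ]

open Classical in
theorem collCount_succ (B : ℕ → ℕ → Bool) (t : ℕ) (τ₁ τ₂ : ℝ) (j j' i N : ℕ) :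
    collCount B t τ₁ τ₂ j j' i (N + 1) = collCount B t τ₁ τ₂ j j' i N +
      if B N j = true ∧ (τ₁ ≤ N ∧ (N : ℝ) ≤ τ₂) ∧ SlipBit B t j' i N then 1 else 0 :=
  by rw [collCount, collCount, Finset.card_filter, Finset.card_filter, Finset.sum_range_succ]

end Counts

/-- One pass of the loop of `countWeights`. -/
def countStep : Cmd :=
  .ifThen (.bit vR vJ)
    (.seq
      (.ifThen (.realLe (.ofNat vR) vTau1) (.setNat 8 (.add vUpper (.lit 1))))
      (.ifThen (.and (.realLe vTau1 (.ofNat vR)) (.realLe (.ofNat vR) vTau2))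
        (.seq (.setNat 9 (.add vLower (.lit 1)))
        (.ifThen
          (.or
            (.or (.bit (.mod (.add (.add vR vI) (.sub vT (.lit 1))) vT) vJ2)
              (.bit (.mod (.add vR vI) vT) vJ2))
            (.bit (.mod (.add (.add vR vI) (.lit 1)) vT) vJ2))
          (.setNat 10 (.add vColl (.lit 1)))))))

open Classical in
theorem exec_ifThen (ω : ℕ → unitInterval) (b : Test) (a : Cmd) (s : State) :
    (Cmd.ifThen b a).exec ω s =
      if b.eval s then a.exec ω (s.charge (b.cost + 1)) else s.charge (b.cost + 1) := by
  simp only [Cmd.exec]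

theorem exec_seq (ω : ℕ → unitInterval) (a b : Cmd) (s : State) :
    (Cmd.seq a b).exec ω s = b.exec ω (a.exec ω s) := by
  simp only [Cmd.exec]

open Classical in
theorem exec_countStep (ω : ℕ → unitInterval) (s : State) :
    (countStep.exec ω s).nat 8 = s.nat 8 +
      (if s.bit (s.nat 7) (s.nat 4) = true ∧ (s.nat 7 : ℝ) ≤ s.real 5 then 1 else 0) ∧
    (countStep.exec ω s).nat 9 = s.nat 9 +
      (if s.bit (s.nat 7) (s.nat 4) = true ∧ (s.real 5 ≤ s.nat 7 ∧ (s.nat 7 : ℝ) ≤ s.real 6)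
        then 1 else 0) ∧
    (countStep.exec ω s).nat 10 = s.nat 10 +
      (if s.bit (s.nat 7) (s.nat 4) = true ∧ (s.real 5 ≤ s.nat 7 ∧ (s.nat 7 : ℝ) ≤ s.real 6) ∧
        SlipBit s.bit (s.nat 1) (s.nat 5) (s.nat 6) (s.nat 7) then 1 else 0) := by
  rw [countStep, exec_ifThen]
  by_cases c1 : s.bit (s.nat 7) (s.nat 4) = true
  swap
  · simp [Test.eval, NatExp.eval, c1]
  rw [if_pos (by exact c1), exec_seq]
  generalize hs1 : Cmd.exec ω (.ifThen (.realLe (.ofNat vR) vTau1) _) (s.charge _) = s1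
  -- The first conditional changes only register 8, so the later guards still read the original
  -- values.
  have h1 : s1.nat 8 = s.nat 8 + (if (s.nat 7 : ℝ) ≤ s.real 5 then 1 else 0) ∧
      (∀ x, x ≠ 8 → s1.nat x = s.nat x) ∧ s1.real = s.real ∧ s1.bit = s.bit := by
    rw [← hs1, exec_ifThen]
    by_cases h : (s.nat 7 : ℝ) ≤ s.real 5
    · rw [if_pos (by exact h), if_pos h]
      simp +contextual [NatExp.eval, Cmd.exec]
    · rw [if_neg (by exact h), if_neg h]
      simp
  obtain ⟨h8, hx, hr, hb⟩ := h1
  rw [exec_ifThen]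
  have e1 := hx 1 (by decide)
  have e4 := hx 4 (by decide)
  have e5 := hx 5 (by decide)
  have e6 := hx 6 (by decide)
  have e7 := hx 7 (by decide)
  have e9 := hx 9 (by decide)
  have e10 := hx 10 (by decide)
  by_cases c2 : s.real 5 ≤ s.nat 7 ∧ (s.nat 7 : ℝ) ≤ s.real 6
  · by_cases c3 : SlipBit s.bit (s.nat 1) (s.nat 5) (s.nat 6) (s.nat 7)
    · rw [if_pos (by simpa [Test.eval, RealExp.eval, NatExp.eval, hr, e7] using c2),
        exec_seq, exec_ifThen, if_pos (by
          simpa [Test.eval, Cmd.exec, NatExp.eval, hb, e7, e6, e5, e1, SlipBit] using c3)]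
      simp [NatExp.eval, Cmd.exec, c1, c2, c3, h8, e9, e10]
    · rw [if_pos (by simpa [Test.eval, RealExp.eval, NatExp.eval, hr, e7] using c2),
        exec_seq, exec_ifThen, if_neg (by
          simpa [Test.eval, Cmd.exec, NatExp.eval, hb, e7, e6, e5, e1, SlipBit] using c3)]
      simp [NatExp.eval, Cmd.exec, c1, c2, c3, h8, e9, e10]
  · rw [if_neg (by simpa [Test.eval, RealExp.eval, NatExp.eval, hr, e7] using c2)]
    simp [c1, c2, h8, e9, e10]

open Classical in
theorem exec_countWeights (ω : ℕ → unitInterval) (s : State) :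
    (countWeights.exec ω s).nat 8 = upperCount s.bit (s.real 5) (s.nat 4) (s.nat 1) ∧
    (countWeights.exec ω s).nat 9 = lowerCount s.bit (s.real 5) (s.real 6) (s.nat 4) (s.nat 1) ∧
    (countWeights.exec ω s).nat 10 = collCount s.bit (s.nat 1) (s.real 5) (s.real 6) (s.nat 4)
      (s.nat 5) (s.nat 6) (s.nat 1) := by
  have hc : countWeights = .seq (.setNat 8 (.lit 0)) (.seq (.setNat 9 (.lit 0))
    (.seq (.setNat 10 (.lit 0)) (.forLoop 7 vT countStep))) := rfl
  rw [hc, exec_seq, exec_seq, exec_seq]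
  generalize hs3 : Cmd.exec ω (.setNat 10 (.lit 0)) _ = s3
  have h3 : s3.nat 8 = 0 ∧ s3.nat 9 = 0 ∧ s3.nat 10 = 0 ∧ s3.nat 1 = s.nat 1 ∧
      s3.nat 4 = s.nat 4 ∧ s3.nat 5 = s.nat 5 ∧ s3.nat 6 = s.nat 6 ∧ s3.real = s.real ∧
      s3.bit = s.bit := by
    rw [← hs3]; simp [Cmd.exec, NatExp.eval]
  obtain ⟨h8, h9, h10, h1, h4, h5, h6, hr, hb⟩ := h3
  -- Invariant: after `N` passes the counters hold the counts over the first `N` positions.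
  have key := Cmd.exec_forLoop_induction (ω := ω) (x := 7) (e := vT) (body := countStep) (s := s3)
    (fun N s' => (s'.nat 8 = upperCount s.bit (s.real 5) (s.nat 4) N ∧
      s'.nat 9 = lowerCount s.bit (s.real 5) (s.real 6) (s.nat 4) N ∧
      s'.nat 10 = collCount s.bit (s.nat 1) (s.real 5) (s.real 6) (s.nat 4) (s.nat 5) (s.nat 6) N) ∧
      s'.nat 1 = s.nat 1 ∧ s'.nat 4 = s.nat 4 ∧ s'.nat 5 = s.nat 5 ∧ s'.nat 6 = s.nat 6 ∧
      s'.real 5 = s.real 5 ∧ s'.real 6 = s.real 6 ∧ s'.bit = s.bit)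
    ⟨by simp [upperCount, lowerCount, collCount, h8, h9, h10],
      by simp [h1, h4, h5, h6, hr, hb]⟩
    (by
      rintro r - s' ⟨⟨h8, h9, h10⟩, h1, h4, h5, h6, hr5, hr6, hb⟩
      obtain ⟨k8, k9, k10⟩ := exec_countStep ω
        (({ s' with nat := Function.update s'.nat 7 r } : State).charge 1)
      refine ⟨⟨?_, ?_, ?_⟩, ?_⟩
      · rw [k8, upperCount_succ, ← h8]
        simp [h4, hr5, hb]
      · rw [k9, lowerCount_succ, ← h9]
        simp [h4, hr5, hr6, hb]
      · rw [k10, collCount_succ, ← h10]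
        exact congrArg₂ _ (by simp) (if_congr (by simp [h1, h4, h5, h6, hr5, hr6, hb]) rfl rfl)
      · rw [Cmd.exec_nat (by decide), Cmd.exec_nat (by decide), Cmd.exec_nat (by decide),
          Cmd.exec_nat (by decide), Cmd.exec_real (by decide), Cmd.exec_real (by decide),
          (Cmd.exec_bit_pos (by decide) _).1]
        simp [h1, h4, h5, h6, hr5, hr6, hb])
  have e : NatExp.eval s3 vT = s.nat 1 := h1
  rw [e] at key
  exact key.1

/-- The conditions that are checked for the columns `j` and `j'`, the `i`-th shift and `k`. -/
def Good (B : ℕ → ℕ → Bool) (t : ℕ) (a τ₁ τ₂ : ℝ) (k j j' i : ℕ) : Prop :=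
  (upperCount B τ₁ j t : ℝ) ≤ a * lowerCount B τ₁ τ₂ j t ∧
    (collCount B t τ₁ τ₂ j j' i t : ℝ) ≤
      (⌊(a * lowerCount B τ₁ τ₂ j t - 1) / ((k : ℝ) - 1)⌋ : ℤ)

/-- The body of the innermost loop of `check` around `countWeights`. -/
def testStep : Cmd :=
  .seq countWeights (.ifThen (.neg (.and weightTest collisionTest)) (.setNat 11 (.lit 0)))

theorem exec_testStep (ω : ℕ → unitInterval) (s : State) :
    (testStep.exec ω s).nat 11 = 1 ↔ s.nat 11 = 1 ∧ Good s.bit (s.nat 1) (s.real 3) (s.real 5)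
      (s.real 6) (s.nat 3) (s.nat 4) (s.nat 5) (s.nat 6) := by
  obtain ⟨h8, h9, h10⟩ := exec_countWeights ω s
  have h11 : (countWeights.exec ω s).nat 11 = s.nat 11 := Cmd.exec_nat (by decide) s
  have h3 : (countWeights.exec ω s).nat 3 = s.nat 3 := Cmd.exec_nat (by decide) s
  have hr3 : (countWeights.exec ω s).real 3 = s.real 3 := Cmd.exec_real (by decide) s
  rw [testStep, exec_seq, exec_ifThen]
  generalize countWeights.exec ω s = s' at *
  have key : (Test.neg (.and weightTest collisionTest)).eval s' ↔ ¬ Good s.bit (s.nat 1) (s.real 3)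
      (s.real 5) (s.real 6) (s.nat 3) (s.nat 4) (s.nat 5) (s.nat 6) := by
    simp only [Test.eval, weightTest, collisionTest, RealExp.eval, NatExp.eval, h8, h9, h10, h3,
      hr3, Good, Nat.cast_one]
  by_cases hg : Good s.bit (s.nat 1) (s.real 3) (s.real 5) (s.real 6) (s.nat 3) (s.nat 4)
    (s.nat 5) (s.nat 6)
  · rw [if_neg (by rw [key]; exact not_not.2 hg)]
    simp [h11, hg]
  · rw [if_pos (by rw [key]; exact hg)]
    simp [Cmd.exec, NatExp.eval, hg]

/-- The value of `τ₁` for `k`. -/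
noncomputable def lowTau (b : ℝ) (n k : ℕ) : ℝ := b / 64 * ((k : ℝ) * k) * Real.log n

/-- The value of `τ₂` for `k`. -/
noncomputable def highTau (a b ε : ℝ) (n k : ℕ) : ℝ :=
  b * ((k : ℝ) * k / a ^ (2 + ε)) * Real.log n

theorem exec_setTaus (ω : ℕ → unitInterval) (s : State) :
    (setTaus.exec ω s).real 5 = lowTau (s.real 4) (s.nat 0) (s.nat 3) ∧
    (setTaus.exec ω s).real 6 = highTau (s.real 3) (s.real 4) (s.real 1) (s.nat 0) (s.nat 3) := by
  simp [setTaus, Cmd.exec, RealExp.eval, NatExp.eval, lowTau, highTau]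

/-- The condition that is checked for a matrix. -/
def Passes (n t Δ : ℕ) (a b ε : ℝ) (B : ℕ → ℕ → Bool) : Prop :=
  ∀ k < Δ + 1, 1 < k → ∀ j < n, ∀ j' < n, j ≠ j' → ∀ i < t,
    Good B t a (lowTau b n k) (highTau a b ε n k) k j j' i

/-- The flag in register 11 is set once and afterwards only cleared, so each of the four nested
loops contributes one bounded universal quantifier through `exec_forLoop_flag`. -/
theorem exec_check (ω : ℕ → unitInterval) (s : State) :
    (check.exec ω s).nat 11 = 1 ↔
      Passes (s.nat 0) (s.nat 1) (s.nat 2) (s.real 3) (s.real 4) (s.real 1) s.bit := by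
  let loopI : Cmd := .forLoop 6 vT testStep
  have hI (s : State) : (loopI.exec ω s).nat 11 = 1 ↔ s.nat 11 = 1 ∧ ∀ i < s.nat 1,
      Good s.bit (s.nat 1) (s.real 3) (s.real 5) (s.real 6) (s.nat 3) (s.nat 4) (s.nat 5) i := by
    refine Cmd.exec_forLoop_flag _ (by decide) (by decide) fun i _ s' h1 h2 h3 h4 => ?_
    rw [exec_testStep, h1 1 (by decide), h1 3 (by decide), h1 4 (by decide), h1 5 (by decide),
      h2 3 (by decide), h2 5 (by decide), h2 6 (by decide), h3, h4]
  let loopJ2 : Cmd := .forLoop 5 vN (.ifThen (.neg (.natEq vJ vJ2)) loopI)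
  have hJ2 (s : State) : (loopJ2.exec ω s).nat 11 = 1 ↔ s.nat 11 = 1 ∧ ∀ j' < s.nat 0,
      s.nat 4 ≠ j' → ∀ i < s.nat 1,
      Good s.bit (s.nat 1) (s.real 3) (s.real 5) (s.real 6) (s.nat 3) (s.nat 4) j' i := by
    refine Cmd.exec_forLoop_flag _ (by decide) (by decide) fun i _ s' h1 h2 h3 h4 => ?_
    rw [exec_ifThen]
    by_cases h : s.nat 4 = i
    · rw [if_neg (by simp [Test.eval, NatExp.eval, h1 4 (by decide), h4, h])]
      simp [h]
    · rw [if_pos (by simpa [Test.eval, NatExp.eval, h1 4 (by decide), h4] using h), hI]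
      simp only [State.charge_nat, State.charge_bit, State.charge_real]
      rw [h1 1 (by decide), h1 3 (by decide), h1 4 (by decide),
        h2 3 (by decide), h2 5 (by decide), h2 6 (by decide), h3, h4]
      simp [h]
  let loopJ : Cmd := .forLoop 4 vN loopJ2
  have hJ (s : State) : (loopJ.exec ω s).nat 11 = 1 ↔ s.nat 11 = 1 ∧ ∀ j < s.nat 0, ∀ j' < s.nat 0,
      j ≠ j' → ∀ i < s.nat 1,
      Good s.bit (s.nat 1) (s.real 3) (s.real 5) (s.real 6) (s.nat 3) j j' i := by
    refine Cmd.exec_forLoop_flag _ (by decide) (by decide) fun i _ s' h1 h2 h3 h4 => ?_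
    rw [hJ2, h1 0 (by decide), h1 1 (by decide), h1 3 (by decide),
      h2 3 (by decide), h2 5 (by decide), h2 6 (by decide), h3, h4]
  have hc : check = .seq (.setNat 11 (.lit 1)) (.forLoop 3 (.add vDelta (.lit 1))
    (.ifThen (.natLt (.lit 1) vK) (.seq setTaus loopJ))) := rfl
  rw [hc, exec_seq]
  generalize hs1 : Cmd.exec ω (.setNat 11 (.lit 1)) s = s1
  have h11 : s1.nat 11 = 1 := by rw [← hs1]; simp [Cmd.exec, NatExp.eval]
  have e0 : s1.nat 0 = s.nat 0 := by rw [← hs1]; exact Cmd.exec_nat (by decide) s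
  have e1 : s1.nat 1 = s.nat 1 := by rw [← hs1]; exact Cmd.exec_nat (by decide) s
  have e2 : s1.nat 2 = s.nat 2 := by rw [← hs1]; exact Cmd.exec_nat (by decide) s
  have er : s1.real = s.real := by rw [← hs1]; rfl
  have eb : s1.bit = s.bit := by rw [← hs1]; rfl
  rw [Cmd.exec_forLoop_flag (y := 11) (fun k => 1 < k → ∀ j < s1.nat 0, ∀ j' < s1.nat 0,
    j ≠ j' → ∀ i < s1.nat 1, Good s1.bit (s1.nat 1) (s1.real 3) (lowTau (s1.real 4) (s1.nat 0) k)
      (highTau (s1.real 3) (s1.real 4) (s1.real 1) (s1.nat 0) k) k j j' i) (by decide) (by decide)]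
  · simp only [h11, true_and, e0, e1, er, eb, Passes, NatExp.eval, e2]
  · intro i _ s' h1 h2 h3 h4
    rw [exec_ifThen]
    by_cases h : 1 < i
    · rw [if_pos (by simpa [Test.eval, NatExp.eval, h4] using h), exec_seq, hJ]
      rw [Cmd.exec_nat (by decide), Cmd.exec_nat (by decide), Cmd.exec_nat (by decide),
        Cmd.exec_nat (by decide), Cmd.exec_real (x := 3) (by decide),
        (Cmd.exec_bit_pos (by decide) _).1, (exec_setTaus _ _).1, (exec_setTaus _ _).2]
      simp only [State.charge_nat, State.charge_bit, State.charge_real]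
      rw [h1 0 (by decide), h1 1 (by decide), h2 3 (by decide), h2 4 (by decide), h2 1 (by decide),
        h3, h4]
      simp [h]
    · rw [if_neg (by simpa [Test.eval, NatExp.eval, h4] using h)]
      simp [h]

/-- The bias of the coins for the positions `r`. -/
noncomputable def bias (n r : ℕ) : ℝ := √(1 / (((⌊(r : ℝ) / Real.log n⌋ : ℤ) : ℝ) + 1))

/-- The bits that are generated from the coins `ω pos, ω (pos + 1), …`. -/
noncomputable def genBit (n : ℕ) (ω : ℕ → unitInterval) (pos r j : ℕ) : Bool :=
  decide ((ω (pos + r * n + j) : ℝ) ≤ bias n r)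

/-- The entry `(r, j)` consumes coin number `pos + r * n + j`. Distinct entries thus use distinct
coins, which is the source of all independence below. -/
theorem exec_generate (ω : ℕ → unitInterval) (s : State) :
    (∀ r < s.nat 1, ∀ j < s.nat 0,
      (generate.exec ω s).bit r j = genBit (s.nat 0) ω s.pos r j) ∧
    (generate.exec ω s).pos = s.pos + s.nat 1 * s.nat 0 := by
  let tossStep : Cmd := .toss vR vJ
    (.sqrt (.div (num 1) (.add (.floor (.div (.ofNat vR) lnN)) (num 1))))
  let loopJ : Cmd := .forLoop 4 vN tossStep
  have hJ (s : State) : (∀ j < s.nat 0, (loopJ.exec ω s).bit (s.nat 7) j =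
        decide ((ω (s.pos + j) : ℝ) ≤ bias (s.nat 0) (s.nat 7))) ∧
      (∀ r j, r ≠ s.nat 7 → (loopJ.exec ω s).bit r j = s.bit r j) ∧
      (loopJ.exec ω s).pos = s.pos + s.nat 0 := by
    have := Cmd.exec_forLoop_induction (ω := ω) (s := s) (x := 4) (e := vN) (body := tossStep)
      (fun N s' => ((∀ j < N, s'.bit (s.nat 7) j =
        decide ((ω (s.pos + j) : ℝ) ≤ bias (s.nat 0) (s.nat 7))) ∧
      (∀ r j, r ≠ s.nat 7 → s'.bit r j = s.bit r j) ∧ s'.pos = s.pos + N) ∧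
      s'.nat 7 = s.nat 7 ∧ s'.nat 0 = s.nat 0) (by simp) ?_
    · exact this.1
    · rintro i - s' ⟨⟨h1, h2, h3⟩, h4, h5⟩
      refine ⟨⟨fun j hj => ?_, fun r j hr => ?_, ?_⟩, ?_, ?_⟩
      · by_cases hji : j = i
        · subst hji
          simp [tossStep, Cmd.exec, RealExp.eval, NatExp.eval, h4, h5, h3, bias]
        · have := h1 j (by omega)
          simp [tossStep, Cmd.exec, RealExp.eval, NatExp.eval, h4, hji, this]
      · have := h2 r j hr
        simp [tossStep, Cmd.exec, RealExp.eval, NatExp.eval, h4, hr, this]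
      · simp [tossStep, Cmd.exec, h3, add_assoc]
      · simp [tossStep, Cmd.exec, h4]
      · simp [tossStep, Cmd.exec, h5]
  have hg : generate = .forLoop 7 vT loopJ := rfl
  rw [hg]
  have := Cmd.exec_forLoop_induction (ω := ω) (s := s) (x := 7) (e := vT) (body := loopJ)
    (fun N s' => ((∀ r < N, ∀ j < s.nat 0, s'.bit r j = genBit (s.nat 0) ω s.pos r j) ∧
      s'.pos = s.pos + N * s.nat 0) ∧ s'.nat 0 = s.nat 0) (by simp) ?_
  · exact this.1
  · rintro i - s' ⟨⟨h1, h2⟩, h3⟩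
    obtain ⟨k1, k2, k3⟩ := hJ (({ s' with nat := Function.update s'.nat 7 i } : State).charge 1)
    simp only [State.charge_nat, State.charge_bit, State.charge_pos, Function.update_self,
      Function.update_of_ne (show (0 : ℕ) ≠ 7 by decide)] at k1 k2 k3
    refine ⟨⟨fun r hr j hj => ?_, ?_⟩, ?_⟩
    · by_cases hri : r = i
      · subst hri
        rw [k1 j (by rw [h3]; exact hj), h2, h3, genBit]
      · rw [k2 r j hri, h1 r (by omega) j hj]
    · rw [k3, h2, h3]
      ring
    · rw [Cmd.exec_nat (by decide)]
      simp [h3]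

/-- Candidates are tried in increasing order, so the last one accepted is the greatest. The
singleton `{0}` stands for the initial value, because the guard skips the pass `k = 0`. -/
theorem exec_setupCmd (ω : ℕ → unitInterval) (s : State) :
    (setupCmd.exec ω s).real 3 = s.real 0 / 2 ∧
    (setupCmd.exec ω s).real 4 = s.real 2 / 2 ^ (2 + s.real 1) ∧
    IsGreatest ({0} ∪ {k : ℕ | k < s.nat 0 + 1 ∧
        highTau (s.real 0 / 2) (s.real 2 / 2 ^ (2 + s.real 1)) (s.real 1) (s.nat 0) k ≤ s.nat 1})
      ((setupCmd.exec ω s).nat 2) := by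
  let step : Cmd := .ifThen (.natLt (.lit 0) vK)
      (.seq setTaus (.ifThen (.realLe vTau2 (.ofNat vT)) (.setNat 2 vK)))
  have hc : setupCmd = .seq (.setReal 3 (.div vAlpha (num 2)))
    (.seq (.setReal 4 (.div vC (.rpow (num 2) (.add (num 2) vEps))))
    (.seq (.setNat 2 (.lit 0)) (.forLoop 3 (.add vN (.lit 1)) step))) := rfl
  rw [hc, exec_seq, exec_seq, exec_seq]
  generalize hs1 : Cmd.exec ω (.setNat 2 (.lit 0)) _ = s1
  have h2 : s1.nat 2 = 0 := by rw [← hs1]; simp [Cmd.exec, NatExp.eval]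
  have e0 : s1.nat 0 = s.nat 0 := by rw [← hs1]; simp [Cmd.exec, NatExp.eval]
  have e1 : s1.nat 1 = s.nat 1 := by rw [← hs1]; simp [Cmd.exec, NatExp.eval]
  have e3 : s1.real 3 = s.real 0 / 2 := by
    rw [← hs1]; simp [Cmd.exec, NatExp.eval, RealExp.eval]
  have e4 : s1.real 4 = s.real 2 / 2 ^ (2 + s.real 1) := by
    rw [← hs1]; simp [Cmd.exec, NatExp.eval, RealExp.eval]
  have e5 : s1.real 1 = s.real 1 := by
    rw [← hs1]; simp [Cmd.exec, NatExp.eval, RealExp.eval]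
  rw [← e3, ← e4, ← e5, ← e0, ← e1]
  refine ⟨Cmd.exec_real (by decide) _, Cmd.exec_real (by decide) _, ?_⟩
  refine (Cmd.exec_forLoop_induction (ω := ω) (s := s1) (x := 3) (e := .add vN (.lit 1))
    (body := step) (fun N s' => IsGreatest ({0} ∪ {k : ℕ | k < N ∧
        highTau (s1.real 3) (s1.real 4) (s1.real 1) (s1.nat 0) k ≤ s1.nat 1}) (s'.nat 2) ∧
      s'.nat 0 = s1.nat 0 ∧ s'.nat 1 = s1.nat 1 ∧ s'.real 3 = s1.real 3 ∧ s'.real 4 = s1.real 4 ∧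
      s'.real 1 = s1.real 1) (by simp [h2]) ?_).1
  rintro i - s' ⟨hg, k0, k1, k3, k4, k5⟩
  refine ⟨?_, by rw [Cmd.exec_nat (by decide)]; simp [k0],
    by rw [Cmd.exec_nat (by decide)]; simp [k1], by rw [Cmd.exec_real (by decide)]; simp [k3],
    by rw [Cmd.exec_real (by decide)]; simp [k4], by rw [Cmd.exec_real (by decide)]; simp [k5]⟩
  rw [exec_ifThen]
  by_cases hi : 0 < i
  · rw [if_pos (by simpa [Test.eval, NatExp.eval] using hi), exec_seq]
    generalize hs2 : Cmd.exec ω setTaus _ = s2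
    have m3 : s2.nat 3 = i := by rw [← hs2, Cmd.exec_nat (by decide)]; simp
    have m2 : s2.nat 2 = s'.nat 2 := by rw [← hs2, Cmd.exec_nat (by decide)]; simp
    have m1 : s2.nat 1 = s1.nat 1 := by rw [← hs2, Cmd.exec_nat (by decide)]; simp [k1]
    have m6 : s2.real 6 = highTau (s1.real 3) (s1.real 4) (s1.real 1) (s1.nat 0) i := by
      rw [← hs2, (exec_setTaus _ _).2]; simp [k0, k3, k4, k5]
    rw [exec_ifThen]
    by_cases ht : highTau (s1.real 3) (s1.real 4) (s1.real 1) (s1.nat 0) i ≤ s1.nat 1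
    · rw [if_pos (by simpa [Test.eval, NatExp.eval, RealExp.eval, m6, m1] using ht)]
      have : (Cmd.exec ω (.setNat 2 vK) (s2.charge
          ((Test.realLe vTau2 (.ofNat vT)).cost + 1))).nat 2 = i := by
        simp [Cmd.exec, NatExp.eval, m3]
      rw [this]
      refine ⟨.inr ⟨Nat.lt_succ_self i, ht⟩, ?_⟩
      rintro k (rfl | ⟨hk, -⟩)
      · exact Nat.zero_le i
      · exact Nat.lt_succ_iff.1 hk
    · rw [if_neg (by simpa [Test.eval, NatExp.eval, RealExp.eval, m6, m1] using ht),
        State.charge_nat, m2]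
      refine ⟨hg.1.imp_right fun h => ⟨h.1.trans (Nat.lt_succ_self i), h.2⟩, ?_⟩
      rintro k (rfl | ⟨hk, hk'⟩)
      · exact Nat.zero_le _
      · rcases Nat.lt_succ_iff_lt_or_eq.1 hk with h | rfl
        · exact hg.2 (.inr ⟨h, hk'⟩)
        · exact absurd hk' ht
  · rw [if_neg (by simpa [Test.eval, NatExp.eval] using hi)]
    have : i = 0 := by omega
    subst this
    simp only [not_lt_zero, false_and, Set.ofPred_false, Set.union_empty] at hg
    have h0 : s'.nat 2 = 0 := hg.1
    simp only [State.charge_nat]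
    rw [Function.update_of_ne (by decide), h0]
    refine ⟨.inl rfl, ?_⟩
    rintro k (rfl | ⟨hk, -⟩)
    · exact le_rfl
    · omega

/-! ### A matrix that passes the check is an ultra-resilient superimposed code. -/

/-- The factors `2^(2+ε)` in `b` and in `a^(2+ε)` cancel. -/
theorem elongation_eq_highTau {c α ε : ℝ} (hα : 0 < α) (n k : ℕ) :
    elongation c α ε n k = highTau (α / 2) (c / 2 ^ (2 + ε)) ε n k := by
  have h1 : (0 : ℝ) < 2 ^ (2 + ε) := by positivity
  have h2 : 0 < α ^ (2 + ε) := by positivity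
  rw [elongation, highTau, Real.div_rpow hα.le (by norm_num)]
  field_simp

theorem ncard_fin_eq_card_range (t : ℕ) (P : ℕ → Prop) [DecidablePred P] :
    Set.ncard {r : Fin t | P r} = ((Finset.range t).filter P).card := by
  rw [← Set.ncard_image_of_injective _ Fin.val_injective, ← Set.ncard_coe_finset]
  congr 1
  ext r
  simp only [Set.mem_image, Set.mem_ofPred_eq, Finset.coe_filter, Finset.mem_range]
  exact ⟨fun ⟨x, hx, h⟩ => h ▸ ⟨x.2, hx⟩, fun ⟨h, hr⟩ => ⟨⟨r, h⟩, hr, rfl⟩⟩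

theorem finset_sup_bool_eq_true {ι : Type*} {t : ℕ} (R : Finset ι) (y : ι → Fin t → Bool)
    (r : Fin t) : R.sup y r = true ↔ ∃ m ∈ R, y m r = true := by
  classical
  induction R using Finset.induction_on with
  | empty => simp
  | insert a R ha ih =>
    rw [Finset.sup_insert, Pi.sup_apply, Bool.max_eq_or, Bool.or_eq_true, ih]
    simp

/-- Slipping commutes with bitwise OR. Only the residue of a shift modulo `t` matters, so the shifts
`i < t` of the check cover all shifts. -/
theorem slipped_sup_eq_true {t n : ℕ} {B : ℕ → ℕ → Bool} (R : Finset (Fin n)) (f : Fin n → ℕ)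
    (y : Fin n → Fin t → Bool)
    (hy : ∀ m ∈ R, y m = cyclicShift (f m) (fun r : Fin t => B r m)) (r : Fin t)
    (h : slipped (R.sup y) r = true) : ∃ m ∈ R, SlipBit B t m (f m % t) r := by
  have hb (q : Fin t) (hq : R.sup y q = true) : ∃ m ∈ R, B ((q + f m) % t) m = true := by
    obtain ⟨m, hm, h⟩ := (finset_sup_bool_eq_true R y q).1 hq
    exact ⟨m, hm, by rw [hy m hm] at h; exact h⟩
  simp only [slipped, Pi.sup_apply, cyclicShift, Bool.max_eq_or, Bool.or_eq_true] at h
  rcases h with (h | h) | h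
  · obtain ⟨m, hm, h⟩ := hb _ h
    refine ⟨m, hm, .inl (.inl ?_)⟩
    rw [← h]
    congr 1
    simp only [Nat.mod_add_mod]
    rw [add_right_comm, Nat.add_mod _ (f m % t), Nat.mod_mod, ← Nat.add_mod]
  · obtain ⟨m, hm, h⟩ := hb _ h
    exact ⟨m, hm, .inl (.inr (by rw [← h, Nat.add_mod_mod]))⟩
  · obtain ⟨m, hm, h⟩ := hb _ h
    refine ⟨m, hm, .inr ?_⟩
    rw [← h]
    congr 1
    simp only [Nat.mod_add_mod]
    rw [add_right_comm, Nat.add_mod _ (f m % t), Nat.mod_mod, ← Nat.add_mod]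

/-- A covered one of column `j` lies either up to `τ₁`, where it is counted whether covered or not,
or in `[τ₁, τ₂]`, where it collides with one of the `k - 1` other columns. The two inequalities of
the check bound these two contributions. -/
theorem isURSC_of_passes {n t Δ : ℕ} {α b ε : ℝ} {τ : ℕ → ℕ → ℝ} {B : ℕ → ℕ → Bool}
    (hα : 0 < α) (hB : ∀ j < n, B 0 j = true) (hτ : ∀ k, τ n k = highTau (α / 2) b ε n k)
    (hτ0 : 0 ≤ τ n 1) (ht : 1 ≤ Δ → 0 < t)
    (h : Passes n t Δ (α / 2) b ε B) :
    IsURSC (Matrix.of fun (r : Fin t) (j : Fin n) => B r j) α τ Δ := by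
  classical
  intro k hk1 hkΔ T hT j hj z hz
  obtain ⟨y, hy, rfl⟩ := hz
  have ht := ht (hk1.trans hkΔ)
  choose! f hf using hy
  replace hf : ∀ m ∈ T.erase j, y m = cyclicShift (f m) (fun r : Fin t => B r m) := hf
  set x : Fin t → Bool := (Matrix.of fun (r : Fin t) (j : Fin n) => B r j).col j with hx
  have hcol : weightUpTo x (τ n k) =
      ((Finset.range t).filter fun r : ℕ => (r : ℝ) ≤ τ n k ∧ B r j = true).card :=
    ncard_fin_eq_card_range t fun r : ℕ => (r : ℝ) ≤ τ n k ∧ B r j = true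
  have hcoll : weightUpTo (x ⊓ slipped ((T.erase j).sup y)) (τ n k) ≤
      ((Finset.range t).filter fun r : ℕ => (r : ℝ) ≤ τ n k ∧ B r j = true ∧
        ∃ m ∈ T.erase j, SlipBit B t m (f m % t) r).card := by
    rw [← ncard_fin_eq_card_range t fun r : ℕ => (r : ℝ) ≤ τ n k ∧ B r j = true ∧
        ∃ m ∈ T.erase j, SlipBit B t m (f m % t) r]
    refine Set.ncard_le_ncard (fun r hr => ?_) (Set.toFinite _)
    obtain ⟨h1, h2⟩ := hr
    simp only [Pi.inf_apply, Bool.min_eq_and, Bool.and_eq_true] at h2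
    exact ⟨h1, h2.1, slipped_sup_eq_true _ f y hf r h2.2⟩
  rcases Nat.lt_or_ge 1 k with hk | hk
  · set τ₁ := lowTau b n k
    have hτk := hτ k
    set τ₂ := highTau (α / 2) b ε n k
    set w := lowerCount B τ₁ τ₂ j t with hw
    have hg : ∀ m ∈ T.erase j, Good B t (α / 2) τ₁ τ₂ k j m (f m % t) := fun m hm =>
      h k (Nat.lt_succ_of_le hkΔ) hk j j.2 m m.2
        (fun e => (Finset.mem_erase.1 hm).1 (Fin.ext e.symm)) _ (Nat.mod_lt _ ht)
    have hcard : ((T.erase j).card : ℝ) = k - 1 := by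
      rw [Finset.card_erase_of_mem hj, hT, Nat.cast_sub hk1, Nat.cast_one]
    have hk' : (0 : ℝ) < k - 1 := by
      have : (1 : ℝ) < k := by exact_mod_cast hk
      linarith
    have hup : (upperCount B τ₁ j t : ℝ) ≤ α / 2 * w := by
      -- The weight inequality is only tested inside the loop over `j'`, so another column is needed
      -- to extract it.
      have : (T.erase j).Nonempty := by
        rw [← Finset.card_pos]
        exact_mod_cast hcard ▸ hk'
      obtain ⟨m, hm⟩ := this
      exact (hg m hm).1
    have hc : ∀ m ∈ T.erase j, (collCount B t τ₁ τ₂ j m (f m % t) t : ℝ) ≤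
        (α / 2 * w - 1) / (k - 1) := fun m hm => (hg m hm).2.trans (Int.floor_le _)
    have hsum : ∑ m ∈ T.erase j, (collCount B t τ₁ τ₂ j m (f m % t) t : ℝ) ≤ α / 2 * w - 1 := by
      refine (Finset.sum_le_card_nsmul _ _ _ hc).trans_eq ?_
      rw [nsmul_eq_mul, hcard]
      field_simp
    have hsub : ((Finset.range t).filter fun r : ℕ => (r : ℝ) ≤ τ n k ∧ B r j = true ∧
        ∃ m ∈ T.erase j, SlipBit B t m (f m % t) r) ⊆
        ((Finset.range t).filter fun r : ℕ => B r j = true ∧ (r : ℝ) ≤ τ₁) ∪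
        (T.erase j).biUnion fun m => (Finset.range t).filter fun r : ℕ =>
          B r j = true ∧ (τ₁ ≤ r ∧ (r : ℝ) ≤ τ₂) ∧ SlipBit B t m (f m % t) r := by
      intro r hr
      obtain ⟨h0, h1, h2, m, hm, h3⟩ := Finset.mem_filter.1 hr
      rcases le_total (r : ℝ) τ₁ with h4 | h4
      · exact Finset.mem_union_left _ (Finset.mem_filter.2 ⟨h0, h2, h4⟩)
      · exact Finset.mem_union_right _ (Finset.mem_biUnion.2
          ⟨m, hm, Finset.mem_filter.2 ⟨h0, h2, ⟨h4, hτk ▸ h1⟩, h3⟩⟩)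
    have hle := (hcoll.trans (Finset.card_le_card hsub)).trans ((Finset.card_union_le _ _).trans
      (Nat.add_le_add_left Finset.card_biUnion_le _))
    have hle' : (weightUpTo (x ⊓ slipped ((T.erase j).sup y)) (τ n k) : ℝ) ≤
        upperCount B τ₁ j t + ∑ m ∈ T.erase j, (collCount B t τ₁ τ₂ j m (f m % t) t : ℝ) := by
      rw [← Nat.cast_sum, ← Nat.cast_add]
      exact Nat.cast_le.2 (hle.trans_eq (by simp only [upperCount, collCount]))
    have hww : (w : ℝ) ≤ weightUpTo x (τ n k) := by
      rw [hcol, hw, lowerCount, Nat.cast_le]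
      refine Finset.card_le_card fun r hr => ?_
      obtain ⟨h0, h1, h2, h3⟩ := Finset.mem_filter.1 hr
      exact Finset.mem_filter.2 ⟨h0, hτk ▸ h3, h1⟩
    -- `α/2 * w + (α/2 * w - 1) < α * w`: the `- 1` of the collision inequality makes the bound
    -- strict.
    have := mul_le_mul_of_nonneg_left hww hα.le
    linarith
  -- No other column is present, so it remains to exhibit a one of column `j`; row `0` has it.
  · have hk : k = 1 := by omega
    subst hk
    have he : T.erase j = ∅ := by
      rw [← Finset.card_eq_zero, Finset.card_erase_of_mem hj, hT]
    have h0 : weightUpTo (x ⊓ slipped ((T.erase j).sup y)) (τ n 1) = 0 := by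
      rw [he] at hcoll ⊢
      simpa using hcoll
    have h1 : 0 < weightUpTo x (τ n 1) := by
      rw [hcol, Finset.card_pos]
      exact ⟨0, Finset.mem_filter.2 ⟨Finset.mem_range.2 ht, by simpa using hτ0, hB j j.2⟩⟩
    rw [h0, Nat.cast_zero]
    have : (0 : ℝ) < weightUpTo x (τ n 1) := by exact_mod_cast h1
    positivity

theorem good_congr {B B' : ℕ → ℕ → Bool} {n t : ℕ} (h : ∀ r < t, ∀ j < n, B r j = B' r j)
    {a τ₁ τ₂ : ℝ} {k j j' i : ℕ} (hj : j < n) (hj' : j' < n) :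
    Good B t a τ₁ τ₂ k j j' i ↔ Good B' t a τ₁ τ₂ k j j' i := by
  classical
  have h1 : upperCount B τ₁ j t = upperCount B' τ₁ j t := by
    rw [upperCount, upperCount]
    exact congrArg _ (Finset.filter_congr fun r hr => by rw [h r (Finset.mem_range.1 hr) j hj])
  have h2 : lowerCount B τ₁ τ₂ j t = lowerCount B' τ₁ τ₂ j t := by
    rw [lowerCount, lowerCount]
    exact congrArg _ (Finset.filter_congr fun r hr => by rw [h r (Finset.mem_range.1 hr) j hj])
  have h3 : collCount B t τ₁ τ₂ j j' i t = collCount B' t τ₁ τ₂ j j' i t := by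
    rw [collCount, collCount]
    refine congrArg _ (Finset.filter_congr fun r hr => ?_)
    have hr := Finset.mem_range.1 hr
    have ht : 0 < t := by omega
    rw [h r hr j hj, SlipBit, SlipBit, h _ (Nat.mod_lt _ ht) j' hj', h _ (Nat.mod_lt _ ht) j' hj',
      h _ (Nat.mod_lt _ ht) j' hj']
  rw [Good, Good, h1, h2, h3]

/-- All row indices are reduced modulo `t`, so the check reads only the `t × n` entries. This
replaces the machine's array by the coins, and confines the outcome of a round to its own block of
coins. -/
theorem passes_congr {B B' : ℕ → ℕ → Bool} {n t Δ : ℕ} {a b ε : ℝ}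
    (h : ∀ r < t, ∀ j < n, B r j = B' r j) : Passes n t Δ a b ε B ↔ Passes n t Δ a b ε B' :=
  forall₄_congr fun _ _ _ _ => forall_congr' fun hj => forall₃_congr fun _ hj' _ =>
    forall₂_congr fun _ _ => good_congr h hj hj'

/-! ### Running time of a round and the course of the `repeat` loop. -/

/-- The values of the registers that occur in the bounds of the loops. -/
def boundVals (n t Δ : ℕ) (x : ℕ) : ℕ := if x = 0 then n else if x = 1 then t else Δ

/-- A bound for the running time of the initialization. -/
def setupTime (n t Δ : ℕ) : ℕ := setupCmd.costBound (boundVals n t Δ)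

/-- A bound for the running time of a round. -/
def roundTime (n t Δ : ℕ) : ℕ :=
  algorithm.body.costBound (boundVals n t Δ) + algorithm.halt.cost + 1

theorem setupTime_le {n : ℕ} (t Δ : ℕ) (hn : 1 ≤ n) :
    setupTime n t Δ ≤ 113 * (n ^ 3 * (t + 1) ^ 2) := by
  have h : setupTime n t Δ = 5 + (10 + (2 + (4 + (n + 1) * 46))) := by
    simp [setupTime, setupCmd, Cmd.costBound, NatExp.cost, RealExp.cost, Test.cost, NatExp.value,
      boundVals, setTaus]
  have h1 : n ≤ n ^ 3 := Nat.le_self_pow (by norm_num) n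
  have h2 : 1 ≤ (t + 1) ^ 2 := Nat.one_le_pow _ _ (by omega)
  have h3 : n ^ 3 ≤ n ^ 3 * (t + 1) ^ 2 := Nat.le_mul_of_pos_right _ h2
  omega

/-- The loops over `k`, `j`, `j'`, `i`, `r` dominate, with `Δ + 1 ≤ 2 n`. Lower-order terms are
absorbed from the innermost loop outwards. -/
theorem roundTime_le {n t Δ : ℕ} (hn : 1 ≤ n) (hΔ : Δ ≤ n) :
    roundTime n t Δ ≤ 261 * (n ^ 3 * (t + 1) ^ 2) := by
  have h : roundTime n t Δ = 2 + t * (1 + (2 + n * 18)) + (2 + (4 + (Δ + 1) * (1 + (4 + (34 + (2 +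
      n * (1 + (2 + n * (1 + (5 + (2 + t * (1 + (2 + (2 + (2 + (2 + t * 62))) + 29)))))))))))))
      + 3 + 1 := by
    simp [roundTime, algorithm, check, generate, countWeights, weightTest, collisionTest,
      Cmd.costBound, NatExp.cost, RealExp.cost, Test.cost, NatExp.value, boundVals, setTaus]
  have hT1 : 1 ≤ (t + 1) ^ 2 := Nat.one_le_pow _ _ (by omega)
  have hT2 : t ≤ (t + 1) ^ 2 := by nlinarith
  have hT3 : t * t ≤ (t + 1) ^ 2 := by nlinarith
  have hT4 : t * (38 + 62 * t) ≤ 62 * (t + 1) ^ 2 := by nlinarith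
  set T := (t + 1) ^ 2
  have hn3 : n ≤ n ^ 3 := Nat.le_self_pow (by norm_num) n
  have e1 : 8 + t * (38 + 62 * t) ≤ 70 * T := by omega
  have e2 : 3 + n * (8 + t * (38 + 62 * t)) ≤ 73 * (n * T) := by
    have h1 := Nat.mul_le_mul_left n e1
    have h2 : 1 ≤ n * T := Nat.mul_pos hn hT1
    nlinarith
  have e3 : 41 + n * (3 + n * (8 + t * (38 + 62 * t))) ≤ 114 * (n ^ 2 * T) := by
    have h1 := Nat.mul_le_mul_left n e2
    have h2 : 1 ≤ n ^ 2 * T := Nat.mul_pos (pow_pos hn 2) hT1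
    nlinarith
  have e4 : (Δ + 1) * (41 + n * (3 + n * (8 + t * (38 + 62 * t)))) ≤ 228 * (n ^ 3 * T) := by
    calc _ ≤ (2 * n) * (114 * (n ^ 2 * T)) := Nat.mul_le_mul (by omega) e3
      _ = _ := by ring
  have e5 : t * (3 + 18 * n) ≤ 21 * (n ^ 3 * T) := by
    calc _ ≤ T * (21 * n ^ 3) := Nat.mul_le_mul hT2 (by omega)
      _ = _ := by ring
  have e6 : 1 ≤ n ^ 3 * T := Nat.mul_pos (pow_pos hn 3) hT1
  rw [h]
  ring_nf at e4 e5 e6 ⊢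
  omega

/-- In round `m` (counted from `0`), a matrix that passes the check is generated. Every round tosses
`t * n` coins. -/
def RoundPasses (n t Δ : ℕ) (a b ε : ℝ) (ω : ℕ → unitInterval) (m : ℕ) : Prop :=
  Passes n t Δ a b ε (genBit n ω (m * (t * n)))

theorem after_spec {n t Δ : ℕ} {α ε c : ℝ}
    (hΔ : IsGreatest {d : ℕ | d ≤ n ∧ highTau (α / 2) (c / 2 ^ (2 + ε)) ε n d ≤ t} Δ)
    (ω : ℕ → unitInterval) (m : ℕ) :
    let s := algorithm.after ω (start n t α ε c) m
    (s.nat 0 = n ∧ s.nat 1 = t ∧ s.nat 2 = Δ ∧ s.real 1 = ε ∧ s.real 3 = α / 2 ∧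
      s.real 4 = c / 2 ^ (2 + ε)) ∧ s.pos = m * (t * n) ∧
      s.time ≤ setupTime n t Δ + roundTime n t Δ * m := by
  induction m with
  | zero =>
    intro s
    obtain ⟨h1, h2, h3⟩ := exec_setupCmd ω (start n t α ε c)
    have hs : s = setupCmd.exec ω (start n t α ε c) := rfl
    have e1 : (start n t α ε c).real 1 = ε := by simp [start]
    have e2 : (start n t α ε c).real 0 = α := by simp [start]
    have e3 : (start n t α ε c).real 2 = c := by simp [start]
    have e4 : (start n t α ε c).nat 0 = n := by simp [start]
    have e5 : (start n t α ε c).nat 1 = t := by simp [start]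
    rw [e1, e2, e3, e4, e5] at h3
    rw [e2] at h1
    rw [e1, e3] at h2
    -- `τ₂` vanishes at `k = 0`, so `0` is always admissible and the singleton is absorbed.
    have h0 : (0 : ℕ) ∈ {k : ℕ | k < n + 1 ∧ highTau (α / 2) (c / 2 ^ (2 + ε)) ε n k ≤ t} :=
      ⟨Nat.succ_pos n, by simp [highTau]⟩
    rw [Set.union_eq_self_of_subset_left (Set.singleton_subset_iff.2 h0)] at h3
    refine ⟨⟨?_, ?_, ?_, ?_, h1, h2⟩, ?_, ?_⟩
    · rw [hs, Cmd.exec_nat (by decide), e4]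
    · rw [hs, Cmd.exec_nat (by decide), e5]
    · refine h3.unique ?_
      simpa only [Nat.lt_succ_iff] using hΔ
    · rw [hs, Cmd.exec_real (by decide), e1]
    · rw [hs, (Cmd.exec_bit_pos (by decide) _).2, Nat.zero_mul]
      rfl
    · have := Cmd.exec_time_le (ω := ω) (c := setupCmd) (v := boundVals n t Δ) (P := [0])
        (by decide) (by decide) (start n t α ε c) (by simp [boundVals, start])
      rw [hs]
      simpa [setupTime, start] using this
  | succ m ih =>
    obtain ⟨⟨h0, h1, h2, h3, h4, h5⟩, h6, h7⟩ := ih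
    intro s
    have hs : s = (check.exec ω (generate.exec ω (algorithm.after ω (start n t α ε c) m))).charge
      (algorithm.halt.cost + 1) := rfl
    have hs' : s = (algorithm.body.exec ω (algorithm.after ω (start n t α ε c) m)).charge
      (algorithm.halt.cost + 1) := rfl
    refine ⟨?_, ?_, ?_⟩
    · rw [hs]
      simp only [State.charge_nat, State.charge_real]
      rw [Cmd.exec_nat (by decide), Cmd.exec_nat (by decide), Cmd.exec_nat (by decide),
        Cmd.exec_nat (by decide), Cmd.exec_nat (by decide), Cmd.exec_nat (by decide),
        Cmd.exec_real (by decide), Cmd.exec_real (by decide), Cmd.exec_real (by decide),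
        Cmd.exec_real (by decide), Cmd.exec_real (by decide), Cmd.exec_real (by decide)]
      exact ⟨h0, h1, h2, h3, h4, h5⟩
    · rw [hs, State.charge_pos, (Cmd.exec_bit_pos (by decide) _).2, (exec_generate _ _).2, h6, h0,
        h1]
      ring
    · have := Cmd.exec_time_le (ω := ω) (c := algorithm.body) (v := boundVals n t Δ)
        (P := [0, 1, 2]) (by decide) (by decide) (algorithm.after ω (start n t α ε c) m)
        (by simp [boundVals, h0, h1, h2])
      rw [hs', State.charge_time, mul_add, mul_one]
      simp only [roundTime] at h7 ⊢
      omega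

/-- The check tosses no coins and writes no bits, so at the end of a round the array still holds the
matrix generated in it. -/
theorem after_succ_spec {n t Δ : ℕ} {α ε c : ℝ}
    (hΔ : IsGreatest {d : ℕ | d ≤ n ∧ highTau (α / 2) (c / 2 ^ (2 + ε)) ε n d ≤ t} Δ)
    (ω : ℕ → unitInterval) (m : ℕ) :
    let s := algorithm.after ω (start n t α ε c) (m + 1)
    (∀ r < t, ∀ j < n, s.bit r j = genBit n ω (m * (t * n)) r j) ∧
    (algorithm.halt.eval s ↔
      RoundPasses n t Δ (α / 2) (c / 2 ^ (2 + ε)) ε ω m) := by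
  obtain ⟨⟨h0, h1, h2, h3, h4, h5⟩, h6, -⟩ := after_spec hΔ ω m
  intro s
  have hs : s = (check.exec ω (generate.exec ω (algorithm.after ω (start n t α ε c) m))).charge
    (algorithm.halt.cost + 1) := rfl
  have hg := (exec_generate ω (algorithm.after ω (start n t α ε c) m)).1
  rw [h0, h1, h6] at hg
  refine ⟨?_, ?_⟩
  · rw [hs, State.charge_bit, (Cmd.exec_bit_pos (by decide) _).1]
    exact hg
  · change s.nat 11 = 1 ↔ _
    rw [hs, State.charge_nat, exec_check, Cmd.exec_nat (by decide), Cmd.exec_nat (by decide),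
      Cmd.exec_nat (by decide), Cmd.exec_real (by decide), Cmd.exec_real (by decide),
      Cmd.exec_real (by decide), h0, h1, h2, h3, h4, h5]
    exact passes_congr hg

theorem exists_of_result_eq_some {n t Δ : ℕ} {α ε c : ℝ}
    (hΔ : IsGreatest {d : ℕ | d ≤ n ∧ highTau (α / 2) (c / 2 ^ (2 + ε)) ε n d ≤ t} Δ)
    {ω : ℕ → unitInterval} {s : State}
    (h : algorithm.result ω (start n t α ε c) = some s) :
    ∃ m, RoundPasses n t Δ (α / 2) (c / 2 ^ (2 + ε)) ε ω m ∧
      ∀ r < t, ∀ j < n, s.bit r j = genBit n ω (m * (t * n)) r j := by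
  classical
  rw [Program.result] at h
  split_ifs at h with hm
  obtain rfl := Option.some.inj h
  exact ⟨_, (after_succ_spec hΔ ω _).2.1 (Nat.find_spec hm), (after_succ_spec hΔ ω _).1⟩

theorem runTime_le_of_roundPasses {n t Δ : ℕ} {α ε c : ℝ}
    (hΔ : IsGreatest {d : ℕ | d ≤ n ∧ highTau (α / 2) (c / 2 ^ (2 + ε)) ε n d ≤ t} Δ)
    {ω : ℕ → unitInterval} {m : ℕ}
    (h : RoundPasses n t Δ (α / 2) (c / 2 ^ (2 + ε)) ε ω m) :
    algorithm.runTime ω (start n t α ε c) ≤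
      ((setupTime n t Δ + roundTime n t Δ * (m + 1) : ℕ) : ℝ≥0∞) := by
  classical
  have hm : ∃ m, algorithm.halt.eval (algorithm.after ω (start n t α ε c) (m + 1)) :=
    ⟨m, (after_succ_spec hΔ ω m).2.2 h⟩
  rw [Program.runTime, Program.result, dif_pos hm]
  refine Nat.cast_le.2 ((after_spec hΔ ω _).2.2.trans ?_)
  gcongr
  exact Nat.find_min' hm ((after_succ_spec hΔ ω m).2.2 h)

-- The number of rounds is the number of `m` for which rounds `0, …, m - 1` all fail. If no round
-- ever passes, the series has infinitely many equal nonzero terms, matching the running time `∞`.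
open Classical in
theorem runTime_le_tsum {n t Δ : ℕ} {α ε c : ℝ}
    (hΔ : IsGreatest {d : ℕ | d ≤ n ∧ highTau (α / 2) (c / 2 ^ (2 + ε)) ε n d ≤ t} Δ)
    (ω : ℕ → unitInterval) :
    algorithm.runTime ω (start n t α ε c) ≤ (setupTime n t Δ : ℝ≥0∞) +
      ∑' m : ℕ, Set.indicator
        {ω | ∀ i < m, ¬ RoundPasses n t Δ (α / 2) (c / 2 ^ (2 + ε)) ε ω i}
        (fun _ => (roundTime n t Δ : ℝ≥0∞)) ω := by
  by_cases h : ∃ m, RoundPasses n t Δ (α / 2) (c / 2 ^ (2 + ε)) ε ω m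
  · refine (runTime_le_of_roundPasses hΔ (Nat.find_spec h)).trans ?_
    rw [Nat.cast_add]
    gcongr
    refine le_trans ?_ (ENNReal.sum_le_tsum (Finset.range (Nat.find h + 1)))
    rw [Finset.sum_congr rfl (g := fun _ => (roundTime n t Δ : ℝ≥0∞))]
    · simp [mul_comm]
    · intro m hm
      refine Set.indicator_of_mem ?_ _
      intro i hi
      exact Nat.find_min h (by have := Finset.mem_range.1 hm; omega)
  · push Not at h
    have : ∀ m, Set.indicator
        {ω | ∀ i < m, ¬ RoundPasses n t Δ (α / 2) (c / 2 ^ (2 + ε)) ε ω i}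
        (fun _ => (roundTime n t Δ : ℝ≥0∞)) ω = roundTime n t Δ := fun m =>
      Set.indicator_of_mem (show ω ∈ {ω | ∀ i < m, ¬ RoundPasses n t Δ (α / 2) (c / 2 ^ (2 + ε)) ε
        ω i} from fun i _ => h i) _
    simp only [this]
    have h0 : (roundTime n t Δ : ℝ≥0∞) ≠ 0 := Nat.cast_ne_zero.2 (Nat.succ_ne_zero _)
    rw [ENNReal.tsum_const_eq_top_of_ne_zero h0, add_top]
    exact le_top

end CodeAlg

/-! ### Chernoff bounds for counts of independent events. -/

namespace ProbabilityTheory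

section Counts

variable {Ω ι : Type*} {A : ι → Set Ω}

/-- The number of events with index in `R` that occur. -/
noncomputable def eventCount (A : ι → Set Ω) (R : Finset ι) (ω : Ω) : ℝ :=
  ∑ i ∈ R, (A i).indicator (fun _ => (1 : ℝ)) ω

theorem exp_mul_indicator_one (A : Set Ω) (l : ℝ) (ω : Ω) :
    Real.exp (l * A.indicator (fun _ => (1 : ℝ)) ω) =
      1 + A.indicator (fun _ => Real.exp l - 1) ω := by
  by_cases h : ω ∈ A <;> simp [h]

theorem eventCount_nonneg (R : Finset ι) (ω : Ω) : 0 ≤ eventCount A R ω :=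
  Finset.sum_nonneg fun _ _ => Set.indicator_nonneg (fun _ _ => zero_le_one) _

theorem eventCount_le_card (R : Finset ι) (ω : Ω) : eventCount A R ω ≤ R.card := by
  refine (Finset.sum_le_card_nsmul R _ 1 fun i _ => ?_).trans_eq (by simp)
  exact Set.indicator_le_self' (fun _ _ => zero_le_one) ω

open Classical in
theorem eventCount_eq_card (R : Finset ι) (ω : Ω) :
    eventCount A R ω = ((R.filter fun i => ω ∈ A i).card : ℝ) := by
  rw [eventCount, Finset.card_filter, Nat.cast_sum]
  refine Finset.sum_congr rfl fun i _ => ?_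
  by_cases h : ω ∈ A i <;> simp [h]

variable [MeasurableSpace Ω] {μ : Measure Ω} [IsProbabilityMeasure μ]

/-- `1 + x ≤ exp x` with `x = (exp l - 1) μ(A)`. With this Poisson-type bound, the product over
independent events depends only on the expected count. -/
theorem mgf_indicator_le {A : Set Ω} (hA : MeasurableSet A) (l : ℝ) :
    mgf (A.indicator fun _ => (1 : ℝ)) μ l ≤ Real.exp ((Real.exp l - 1) * μ.real A) := by
  simp only [mgf, exp_mul_indicator_one]
  rw [integral_add (integrable_const _) ((integrable_const _).indicator hA),
    integral_indicator_const _ hA]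
  simp only [integral_const, probReal_univ, smul_eq_mul, mul_one]
  rw [add_comm, mul_comm]
  exact Real.add_one_le_exp _

theorem measurable_eventCount (hA : ∀ i, MeasurableSet (A i)) (R : Finset ι) :
    Measurable (eventCount A R) :=
  Finset.measurable_fun_sum _ fun i _ => measurable_const.indicator (hA i)

theorem integrable_exp_mul_eventCount (hA : ∀ i, MeasurableSet (A i)) (R : Finset ι) (l : ℝ) :
    Integrable (fun ω => Real.exp (l * eventCount A R ω)) μ := by
  refine Integrable.of_bound (C := Real.exp (|l| * R.card))
    ((measurable_eventCount hA R).const_mul l).exp.aestronglyMeasurable (ae_of_all _ fun ω => ?_)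
  rw [Real.norm_eq_abs, abs_of_pos (Real.exp_pos _), Real.exp_le_exp]
  calc l * eventCount A R ω ≤ |l| * eventCount A R ω :=
        mul_le_mul_of_nonneg_right (le_abs_self l) (eventCount_nonneg R ω)
    _ ≤ _ := mul_le_mul_of_nonneg_left (eventCount_le_card R ω) (abs_nonneg l)

theorem mgf_eventCount_le (hi : iIndepSet A μ) (hA : ∀ i, MeasurableSet (A i)) (R : Finset ι)
    (l : ℝ) :
    mgf (eventCount A R) μ l ≤ Real.exp ((Real.exp l - 1) * ∑ i ∈ R, μ.real (A i)) := by
  have h := (hi.iIndepFun_indicator (β := ℝ)).mgf_sum (t := l)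
    (fun i => measurable_const.indicator (hA i)) R
  have he : eventCount A R = ∑ i ∈ R, (A i).indicator fun _ => (1 : ℝ) := by
    ext ω
    simp [eventCount]
  rw [he]
  refine h.trans_le ?_
  rw [Finset.mul_sum, Real.exp_sum]
  exact Finset.prod_le_prod (fun i _ => mgf_nonneg) fun i _ => mgf_indicator_le (hA i) l

/-- Chernoff's bound for the upper tail. -/
theorem measure_le_eventCount_le (hi : iIndepSet A μ) (hA : ∀ i, MeasurableSet (A i))
    (R : Finset ι) {m l : ℝ} (s : ℝ) (hl : 0 ≤ l) (hm : ∑ i ∈ R, μ.real (A i) ≤ m) :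
    μ.real {ω | s ≤ eventCount A R ω} ≤ Real.exp ((Real.exp l - 1) * m - l * s) := by
  refine (measure_ge_le_exp_mul_mgf s hl (integrable_exp_mul_eventCount hA R l)).trans ?_
  rw [sub_eq_neg_add, Real.exp_add, neg_mul]
  gcongr
  refine (mgf_eventCount_le hi hA R l).trans (Real.exp_le_exp.2 ?_)
  exact mul_le_mul_of_nonneg_left hm (by linarith [Real.add_one_le_exp l])

/-- Chernoff's bound for the lower tail. -/
theorem measure_eventCount_le_le (hi : iIndepSet A μ) (hA : ∀ i, MeasurableSet (A i))
    (R : Finset ι) {m l : ℝ} (s : ℝ) (hl : l ≤ 0) (hm : m ≤ ∑ i ∈ R, μ.real (A i)) :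
    μ.real {ω | eventCount A R ω ≤ s} ≤ Real.exp ((Real.exp l - 1) * m - l * s) := by
  refine (measure_le_le_exp_mul_mgf s hl (integrable_exp_mul_eventCount hA R l)).trans ?_
  rw [sub_eq_neg_add, Real.exp_add, neg_mul]
  gcongr
  refine (mgf_eventCount_le hi hA R l).trans (Real.exp_le_exp.2 ?_)
  exact mul_le_mul_of_nonpos_left hm (by linarith [Real.exp_le_one_iff.2 hl])

end Counts

end ProbabilityTheory

/-! ### Independence of coins and of pairs of coins. -/

namespace RAM
open ProbabilityTheory

instance : IsProbabilityMeasure coins := by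
  unfold coins
  infer_instance

theorem iIndepFun_coins : iIndepFun (fun (x : ℕ) (ω : ℕ → unitInterval) => ω x) coins :=
  iIndepFun_infinitePi (X := fun _ u => u) fun _ => measurable_id

/-- The event that the coin `x` with bias `p` shows `1`. -/
def heads (x : ℕ) (p : ℝ) : Set (ℕ → unitInterval) := {ω | (ω x : ℝ) ≤ p}

theorem measurableSet_heads (x : ℕ) (p : ℝ) : MeasurableSet (heads x p) :=
  measurableSet_le (by fun_prop) measurable_const

theorem coins_real_heads (x : ℕ) {p : ℝ} (h0 : 0 ≤ p) (h1 : p ≤ 1) :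
    coins.real (heads x p) = p := by
  have h : heads x p = Function.eval x ⁻¹' Set.Iic (⟨p, h0, h1⟩ : unitInterval) := rfl
  rw [h, measureReal_def, coins, (measurePreserving_eval_infinitePi _ x).measure_preimage
    measurableSet_Iic.nullMeasurableSet, unitInterval.volume_Iic, ENNReal.toReal_ofReal h0]

theorem iIndepSet_heads {ι : Type*} {f : ι → ℕ} (hf : Function.Injective f) (p : ι → ℝ) :
    iIndepSet (fun i => heads (f i) (p i)) coins := by
  rw [iIndepSet_iff_meas_biInter fun i => measurableSet_heads _ _]
  intro S
  exact (iIndepFun_coins.precomp hf).measure_inter_preimage_eq_mul S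
    (sets := fun i => {u : unitInterval | (u : ℝ) ≤ p i})
    fun i _ => measurableSet_le measurable_subtype_coe measurable_const

/-- A collision is the conjunction of two coins. Injectivity on the disjoint sum says that no coin
is shared, neither within a pair nor between pairs, so grouping the coins in pairs preserves
independence. -/
theorem iIndepSet_heads_inter_heads {ι : Type*} {f g : ι → ℕ}
    (h : Function.Injective (Sum.elim f g)) (p q : ι → ℝ) :
    iIndepSet (fun i => heads (f i) (p i) ∩ heads (g i) (q i)) coins ∧
    ∀ i, coins (heads (f i) (p i) ∩ heads (g i) (q i)) =
      coins (heads (f i) (p i)) * coins (heads (g i) (q i)) := by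
  have key := (iIndepSet_iff_meas_biInter fun i => measurableSet_heads _ _).1
    (iIndepSet_heads h (Sum.elim p q))
  have hS (S : Finset ι) : coins (⋂ i ∈ S, heads (f i) (p i) ∩ heads (g i) (q i)) =
      ∏ i ∈ S, coins (heads (f i) (p i)) * coins (heads (g i) (q i)) := by
    -- Both coins of every pair in `S`: the product over the disjoint sum splits into the two
    -- factors.
    have := key (S.disjSum S)
    rw [Finset.prod_disjSum, ← Finset.prod_mul_distrib] at this
    refine Eq.trans ?_ this
    congr 1
    ext ω
    simp only [Set.mem_iInter, Set.mem_inter_iff, Finset.mem_disjSum]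
    constructor
    · rintro h x (⟨i, hi, rfl⟩ | ⟨i, hi, rfl⟩)
      · exact (h i hi).1
      · exact (h i hi).2
    · intro h i hi
      exact ⟨h (.inl i) (.inl ⟨i, hi, rfl⟩), h (.inr i) (.inr ⟨i, hi, rfl⟩)⟩
  have h1 (i : ι) : coins (heads (f i) (p i) ∩ heads (g i) (q i)) =
      coins (heads (f i) (p i)) * coins (heads (g i) (q i)) := by
    simpa using hS {i}
  refine ⟨?_, h1⟩
  rw [iIndepSet_iff_meas_biInter fun i => (measurableSet_heads _ _).inter (measurableSet_heads _ _)]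
  intro S
  rw [hS S]
  exact Finset.prod_congr rfl fun i _ => (h1 i).symm

end RAM

/-! ### Measurability and independence of the rounds. -/

namespace CodeAlg
open RAM ProbabilityTheory

theorem genBit_eq_true {n : ℕ} {ω : ℕ → unitInterval} {pos r j : ℕ} :
    genBit n ω pos r j = true ↔ ω ∈ heads (pos + r * n + j) (bias n r) := by
  simp [genBit, heads]

/-- The event factors through the finite space of `t × n` bit matrices, where every set is
measurable. -/
theorem measurableSet_roundPasses (n t Δ : ℕ) (a b ε : ℝ) (m : ℕ) :
    MeasurableSet {ω | RoundPasses n t Δ a b ε ω m} := by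
  let F : (ℕ → unitInterval) → (Fin t × Fin n → Bool) :=
    fun ω x => genBit n ω (m * (t * n)) x.1 x.2
  have hF : Measurable F := by
    refine measurable_pi_lambda _ fun x => measurable_to_bool ?_
    have : (fun ω => F ω x) ⁻¹' {true} =
        heads (m * (t * n) + x.1 * n + x.2) (bias n x.1) := by
      ext ω
      exact genBit_eq_true
    rw [this]
    exact measurableSet_heads _ _
  let E : (Fin t × Fin n → Bool) → ℕ → ℕ → Bool := fun M r j =>
    if h : r < t ∧ j < n then M (⟨r, h.1⟩, ⟨j, h.2⟩) else false
  have : {ω | RoundPasses n t Δ a b ε ω m} = F ⁻¹' {M | Passes n t Δ a b ε (E M)} := by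
    ext ω
    refine passes_congr fun r hr j hj => ?_
    simp [E, F, hr, hj]
  rw [this]
  exact hF (Set.toFinite _).measurableSet

theorem roundPasses_congr {n t Δ : ℕ} {a b ε : ℝ} {m : ℕ} {ω ω' : ℕ → unitInterval}
    (h : ∀ x, m * (t * n) ≤ x → x < (m + 1) * (t * n) → ω x = ω' x) :
    RoundPasses n t Δ a b ε ω m ↔ RoundPasses n t Δ a b ε ω' m := by
  refine passes_congr fun r hr j hj => ?_
  rw [genBit, genBit, h]
  · omega
  · have : (r + 1) * n ≤ t * n := Nat.mul_le_mul_right n hr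
    rw [add_mul] at *
    omega

/-- The first `m` rounds use only the coins in `S`, round `m` only those in the disjoint block `T`;
hence the failure probabilities multiply. -/
theorem coins_forall_not_roundPasses_le {n t Δ : ℕ} {a b ε : ℝ} {p : ℝ≥0∞}
    (hp : ∀ m, coins {ω | ¬ RoundPasses n t Δ a b ε ω m} ≤ p) (m : ℕ) :
    coins {ω | ∀ i < m, ¬ RoundPasses n t Δ a b ε ω i} ≤ p ^ m := by
  classical
  induction m with
  | zero => simp
  | succ m ih =>
    set N := t * n
    let S := Finset.range (m * N)
    let T := Finset.Ico (m * N) ((m + 1) * N)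
    have hST : Disjoint S T := by
      rw [Finset.disjoint_left]
      intro x hx hx'
      have := Finset.mem_range.1 hx
      have := (Finset.mem_Ico.1 hx').1
      omega
    have hind := iIndepFun_coins.indepFun_finset S T hST fun i => measurable_pi_apply i
    -- Extending finitely many coins by `0` presents each event as a preimage under its own
    -- coordinates; the values outside the block are irrelevant.
    let ext (U : Finset ℕ) (x : U → unitInterval) (k : ℕ) : unitInterval :=
      if h : k ∈ U then x ⟨k, h⟩ else 0
    have hext (U : Finset ℕ) : Measurable (ext U) := by
      refine measurable_pi_lambda _ fun k => ?_
      by_cases h : k ∈ U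
      · simp only [ext, h, dite_true]
        exact measurable_pi_apply _
      · simp only [ext, h, dite_false]
        exact measurable_const
    have hmS : MeasurableSet (ext S ⁻¹' {ω | ∀ i < m, ¬ RoundPasses n t Δ a b ε ω i}) := by
      refine hext S ?_
      have : {ω | ∀ i < m, ¬ RoundPasses n t Δ a b ε ω i} =
          ⋂ i ∈ Finset.range m, {ω | RoundPasses n t Δ a b ε ω i}ᶜ := by
        ext ω
        simp
      rw [this]
      exact Finset.measurableSet_biInter _ fun i _ =>
        (measurableSet_roundPasses _ _ _ _ _ _ i).compl
    have hmT : MeasurableSet (ext T ⁻¹' {ω | ¬ RoundPasses n t Δ a b ε ω m}) :=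
      hext T (measurableSet_roundPasses _ _ _ _ _ _ m).compl
    have hk := hind.measure_inter_preimage_eq_mul _ _ hmS hmT
    have hS : (fun (ω : ℕ → unitInterval) (i : S) => ω i) ⁻¹'
        (ext S ⁻¹' {ω | ∀ i < m, ¬ RoundPasses n t Δ a b ε ω i}) =
        {ω | ∀ i < m, ¬ RoundPasses n t Δ a b ε ω i} := by
      ext ω
      refine forall₂_congr fun i hi => not_congr (roundPasses_congr fun x _ hx => ?_)
      have : x ∈ S := Finset.mem_range.2 (hx.trans_le (Nat.mul_le_mul_right N hi))
      simp [ext, this]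
    have hT : (fun (ω : ℕ → unitInterval) (i : T) => ω i) ⁻¹'
        (ext T ⁻¹' {ω | ¬ RoundPasses n t Δ a b ε ω m}) =
        {ω | ¬ RoundPasses n t Δ a b ε ω m} := by
      ext ω
      refine not_congr (roundPasses_congr fun x hx hx' => ?_)
      have : x ∈ T := Finset.mem_Ico.2 ⟨hx, hx'⟩
      simp [ext, this]
    rw [hS, hT] at hk
    have : {ω | ∀ i < m + 1, ¬ RoundPasses n t Δ a b ε ω i} =
        {ω | ∀ i < m, ¬ RoundPasses n t Δ a b ε ω i} ∩ {ω | ¬ RoundPasses n t Δ a b ε ω m} := by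
      ext ω
      exact Nat.forall_lt_succ_right
    rw [this, hk, pow_succ]
    exact mul_le_mul' ih (hp m)


/-! ### Sums of biases and of products of biases. -/

section Bias

variable {n : ℕ}

theorem half_le_log (hn : 2 ≤ n) : 1 / 2 ≤ Real.log n := by
  have h1 : Real.log 2 ≤ Real.log n :=
    Real.log_le_log (by norm_num) (by exact_mod_cast hn)
  linarith [Real.log_two_gt_d9]

theorem bias_nonneg (n r : ℕ) : 0 ≤ bias n r := Real.sqrt_nonneg _

theorem bias_zero (n : ℕ) : bias n 0 = 1 := by simp [bias]

theorem div_log_nonneg (hn : 2 ≤ n) (r : ℕ) : 0 ≤ (r : ℝ) / Real.log n :=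
  div_nonneg (Nat.cast_nonneg r) (by linarith [half_le_log hn])

theorem bias_antitone (hn : 2 ≤ n) : Antitone (bias n) := by
  intro r s h
  have h0 : (0 : ℤ) ≤ ⌊(r : ℝ) / Real.log n⌋ := Int.floor_nonneg.2 (div_log_nonneg hn r)
  have h1 : ⌊(r : ℝ) / Real.log n⌋ ≤ ⌊(s : ℝ) / Real.log n⌋ := Int.floor_le_floor
    (div_le_div_of_nonneg_right (by exact_mod_cast h) (by linarith [half_le_log hn]))
  have h0' : (0 : ℝ) ≤ (⌊(r : ℝ) / Real.log n⌋ : ℤ) := by exact_mod_cast h0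
  have h1' : ((⌊(r : ℝ) / Real.log n⌋ : ℤ) : ℝ) ≤ (⌊(s : ℝ) / Real.log n⌋ : ℤ) := by
    exact_mod_cast h1
  refine Real.sqrt_le_sqrt (one_div_le_one_div_of_le (by linarith) (by linarith))

theorem bias_le_one (hn : 2 ≤ n) (r : ℕ) : bias n r ≤ 1 :=
  (bias_antitone hn (Nat.zero_le r)).trans_eq (bias_zero n)

/-- With `q = r / ln n`, the sandwich `q < ⌊q⌋ + 1 ≤ q + 1` yields this bound and the matching lower
bound `le_bias`. -/
theorem bias_le (hn : 2 ≤ n) {r : ℕ} (hr : 1 ≤ r) : bias n r ≤ √(Real.log n / r) := by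
  have hL := half_le_log hn
  have hr' : (0 : ℝ) < r := by exact_mod_cast hr
  refine Real.sqrt_le_sqrt ?_
  rw [← one_div_div (r : ℝ)]
  exact one_div_le_one_div_of_le (div_pos hr' (by linarith)) (Int.lt_floor_add_one _).le

theorem le_bias (hn : 2 ≤ n) (r : ℕ) : √(Real.log n / (r + Real.log n)) ≤ bias n r := by
  have hL := half_le_log hn
  have h0 : (0 : ℤ) ≤ ⌊(r : ℝ) / Real.log n⌋ := Int.floor_nonneg.2 (div_log_nonneg hn r)
  have h0' : (0 : ℝ) ≤ (⌊(r : ℝ) / Real.log n⌋ : ℤ) := by exact_mod_cast h0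
  refine Real.sqrt_le_sqrt ?_
  rw [← one_div_div ((r : ℝ) + _), add_div, div_self (by linarith)]
  exact one_div_le_one_div_of_le (by linarith) (by linarith [Int.floor_le ((r : ℝ) / Real.log n)])

theorem sq_bias_le (hn : 2 ≤ n) {r : ℕ} (hr : 1 ≤ r) :
    bias n r * bias n r ≤ Real.log n * (1 / r) := by
  have hL := half_le_log hn
  have h := mul_self_le_mul_self (bias_nonneg n r) (bias_le hn hr)
  rw [Real.mul_self_sqrt (by positivity)] at h
  rwa [mul_one_div]

/-- Telescoping against the integral of `√(L/r)`; the summand `1` is the bias of row `0`. -/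
theorem sum_range_bias_le (hn : 2 ≤ n) (N : ℕ) :
    ∑ r ∈ Finset.range (N + 1), bias n r ≤ 1 + 2 * √(Real.log n * N) := by
  have hL := half_le_log hn
  induction N with
  | zero => simp [bias_zero]
  | succ N ih =>
    rw [Finset.sum_range_succ]
    have hN : (0 : ℝ) < (N + 1 : ℕ) := by positivity
    have h1 : bias n (N + 1) ≤ 2 * (√(Real.log n * (N + 1 : ℕ)) - √(Real.log n * N)) := by
      refine (bias_le hn (Nat.succ_pos N)).trans ?_
      rw [Real.sqrt_div' _ hN.le, Real.sqrt_mul (by linarith), Real.sqrt_mul (by linarith),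
        ← mul_sub, div_le_iff₀ (Real.sqrt_pos.2 hN)]
      have e1 : √((N + 1 : ℕ) : ℝ) * √((N + 1 : ℕ) : ℝ) = N + 1 := by
        rw [Real.mul_self_sqrt hN.le]; push_cast; ring
      have e2 : √(N : ℝ) * √(N : ℝ) = N := Real.mul_self_sqrt (Nat.cast_nonneg N)
      set x := √((N + 1 : ℕ) : ℝ)
      set y := √(N : ℝ)
      -- Since `x² - y² = 1`, one has `2(x - y)x = 1 + (x - y)²`.
      have : 1 ≤ 2 * (x - y) * x := by nlinarith [sq_nonneg (x - y)]
      nlinarith [Real.sqrt_nonneg (Real.log n)]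
    linarith

theorem sum_bias_le (hn : 2 ≤ n) {R : Finset ℕ} {x : ℝ} (hx : 0 ≤ x)
    (hR : ∀ r ∈ R, (r : ℝ) ≤ x) :
    ∑ r ∈ R, bias n r ≤ 1 + 2 * √(Real.log n * x) := by
  have hL := half_le_log hn
  have h1 : R ⊆ Finset.range (⌊x⌋₊ + 1) := fun r hr =>
    Finset.mem_range.2 (Nat.lt_succ_of_le (Nat.le_floor (hR r hr)))
  refine (Finset.sum_le_sum_of_subset_of_nonneg h1 fun r _ _ => bias_nonneg n r).trans
    ((sum_range_bias_le hn _).trans ?_)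
  have := Nat.floor_le hx
  gcongr

theorem le_sum_Ico_bias (hn : 2 ≤ n) {M N : ℕ} (h : M ≤ N) :
    2 * √(Real.log n) * (√(N + Real.log n) - √(M + Real.log n)) ≤
      ∑ r ∈ Finset.Ico M N, bias n r := by
  have hL := half_le_log hn
  induction N, h using Nat.le_induction with
  | base => simp
  | succ N hMN ih =>
    rw [Finset.sum_Ico_succ_top hMN]
    have hN : 0 < (N : ℝ) + Real.log n := by positivity
    have h1 : 2 * √(Real.log n) * (√((N + 1 : ℕ) + Real.log n) - √(N + Real.log n)) ≤
        bias n N := by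
      refine le_trans ?_ (le_bias hn N)
      rw [Real.sqrt_div' _ hN.le, le_div_iff₀ (Real.sqrt_pos.2 hN)]
      have e1 : √((N + 1 : ℕ) + Real.log n) * √((N + 1 : ℕ) + Real.log n) =
          N + Real.log n + 1 := by
        rw [Real.mul_self_sqrt (by positivity)]; push_cast; ring
      have e2 : √(N + Real.log n) * √(N + Real.log n) = N + Real.log n :=
        Real.mul_self_sqrt hN.le
      set x := √((N + 1 : ℕ) + Real.log n)
      set y := √(N + Real.log n)
      -- Likewise `2(x - y)y = 1 - (x - y)²`.
      have : 2 * (x - y) * y ≤ 1 := by nlinarith [sq_nonneg (x - y)]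
      nlinarith [Real.sqrt_nonneg (Real.log n)]
    linarith

theorem sum_Icc_one_div_le {M N : ℕ} (hM : 1 ≤ M) (h : M ≤ N) :
    ∑ r ∈ Finset.Icc M N, 1 / (r : ℝ) ≤ 1 / M + Real.log (N / M) := by
  have hM' : (0 : ℝ) < M := by exact_mod_cast hM
  induction N, h using Nat.le_induction with
  | base => simp [hM'.ne']
  | succ N hMN ih =>
    rw [Finset.sum_Icc_succ_top (by omega)]
    have hN : (0 : ℝ) < N := by
      have : 0 < N := by omega
      exact_mod_cast this
    have hN1 : (0 : ℝ) < (N + 1 : ℕ) := by positivity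
    rw [Real.log_div hN.ne' hM'.ne'] at ih
    rw [Real.log_div hN1.ne' hM'.ne']
    have h1 := Real.log_le_sub_one_of_pos (div_pos hN hN1)
    rw [Real.log_div hN.ne' hN1.ne'] at h1
    have h2 : (N : ℝ) / (N + 1 : ℕ) - 1 = -(1 / (N + 1 : ℕ)) := by
      field_simp
      push_cast
      ring
    linarith

theorem sum_one_div_le {R : Finset ℕ} {x y : ℝ} (hx : 1 ≤ x) (hxy : x ≤ y)
    (hR : ∀ r ∈ R, x ≤ (r : ℝ) ∧ (r : ℝ) ≤ y) :
    ∑ r ∈ R, 1 / (r : ℝ) ≤ 1 / x + Real.log (y / x) := by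
  have hM : 1 ≤ ⌈x⌉₊ := Nat.one_le_ceil_iff.2 (by linarith)
  have hM' : (0 : ℝ) < ⌈x⌉₊ := by exact_mod_cast hM
  have hxM := Nat.le_ceil x
  have hsub : R ⊆ Finset.Icc ⌈x⌉₊ ⌊y⌋₊ := fun r hr =>
    Finset.mem_Icc.2 ⟨Nat.ceil_le.2 (hR r hr).1, Nat.le_floor (hR r hr).2⟩
  refine (Finset.sum_le_sum_of_subset_of_nonneg hsub fun r _ _ => by positivity).trans ?_
  rcases le_or_gt ⌈x⌉₊ ⌊y⌋₊ with h | h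
  · have hN : (0 : ℝ) < ⌊y⌋₊ := by
      have : 0 < ⌊y⌋₊ := by omega
      exact_mod_cast this
    refine (sum_Icc_one_div_le hM h).trans (add_le_add ?_ ?_)
    · exact one_div_le_one_div_of_le (by linarith) hxM
    · refine Real.log_le_log (by positivity) ?_
      exact div_le_div₀ (by linarith) (Nat.floor_le (by linarith)) (by linarith) hxM
  · rw [Finset.Icc_eq_empty (by omega), Finset.sum_empty]
    have := Real.log_nonneg ((one_le_div (by linarith)).2 hxy)
    positivity

/-- The expected number of collisions of a column and a cyclic shift of another one. -/
theorem sum_bias_mul_bias_le (hn : 2 ≤ n) {R : Finset ℕ} {σ : ℕ → ℕ} {x y : ℝ} (hx : 1 ≤ x)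
    (hxy : x ≤ y) (hR : ∀ r ∈ R, x ≤ (r : ℝ) ∧ (r : ℝ) ≤ y) (hσ : Set.InjOn σ R) :
    ∑ r ∈ R, bias n r * bias n (σ r) ≤ √(Real.log n / x) * (1 + 2 * √(Real.log n * x)) +
      2 * (Real.log n * (1 / x + Real.log (y / x))) := by
  classical
  have hL := half_le_log hn
  have hr1 (r : ℕ) (h : x ≤ (r : ℝ)) : 1 ≤ r := by
    have : (1 : ℝ) ≤ r := hx.trans h
    exact_mod_cast this
  let f (s : ℕ) : ℝ := if (s : ℝ) ≤ x then bias n s else 0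
  let g (s : ℕ) : ℝ := if x ≤ (s : ℝ) ∧ (s : ℝ) ≤ y then bias n s * bias n s else 0
  have hf0 (s : ℕ) : 0 ≤ f s := by
    simp only [f]; split_ifs
    exacts [bias_nonneg n s, le_rfl]
  have hg0 (s : ℕ) : 0 ≤ g s := by
    simp only [g]; split_ifs
    exacts [mul_self_nonneg _, le_rfl]
  -- Three cases for the shifted position: up to `x`, the unshifted bias is at most `√(L/x)`; in
  -- `(x, y]`, the product is at most the sum of the squares; beyond `y`, monotonicity gives `bias n
  -- (σ r) ≤ bias n r`.
  have hterm : ∀ r ∈ R, bias n r * bias n (σ r) ≤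
      √(Real.log n / x) * f (σ r) + bias n r * bias n r + g (σ r) := by
    intro r hr
    obtain ⟨h1, h2⟩ := hR r hr
    have hb := bias_nonneg n r
    have hb' := bias_nonneg n (σ r)
    have hsq : 0 ≤ √(Real.log n / x) * f (σ r) := mul_nonneg (Real.sqrt_nonneg _) (hf0 _)
    rcases le_or_gt (σ r : ℝ) x with h3 | h3
    · have h4 : bias n r ≤ √(Real.log n / x) := by
        refine (bias_le hn (hr1 r h1)).trans (Real.sqrt_le_sqrt ?_)
        gcongr
      have h5 : f (σ r) = bias n (σ r) := if_pos h3
      have := mul_le_mul_of_nonneg_right h4 hb'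
      rw [h5]
      linarith [mul_self_nonneg (bias n r), hg0 (σ r)]
    · rcases le_or_gt (σ r : ℝ) y with h4 | h4
      · have h5 : g (σ r) = bias n (σ r) * bias n (σ r) := if_pos ⟨h3.le, h4⟩
        rw [h5]
        nlinarith [sq_nonneg (bias n r - bias n (σ r)), mul_nonneg hb hb']
      · have h5 : bias n (σ r) ≤ bias n r := bias_antitone hn (by exact_mod_cast (h2.trans h4.le))
        have := mul_le_mul_of_nonneg_left h5 hb
        linarith [hg0 (σ r)]
  have hsq (T : Finset ℕ) (hT : ∀ r ∈ T, x ≤ (r : ℝ) ∧ (r : ℝ) ≤ y) :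
      ∑ r ∈ T, bias n r * bias n r ≤ Real.log n * (1 / x + Real.log (y / x)) := by
    refine (Finset.sum_le_sum fun r hr => sq_bias_le hn (hr1 r (hT r hr).1)).trans ?_
    rw [← Finset.mul_sum]
    exact mul_le_mul_of_nonneg_left (sum_one_div_le hx hxy hT) (by linarith)
  -- Injectivity of `σ` turns this into a sum over distinct positions up to `x`; the same is done
  -- for `g` on `[x, y]`.
  have hf : ∑ r ∈ R, f (σ r) ≤ 1 + 2 * √(Real.log n * x) := by
    rw [← Finset.sum_image (f := f) hσ, ← Finset.sum_filter]
    exact sum_bias_le hn (by linarith) fun r hr => (Finset.mem_filter.1 hr).2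
  have hg : ∑ r ∈ R, g (σ r) ≤ Real.log n * (1 / x + Real.log (y / x)) := by
    rw [← Finset.sum_image (f := g) hσ, ← Finset.sum_filter]
    exact hsq _ fun r hr => (Finset.mem_filter.1 hr).2
  refine (Finset.sum_le_sum hterm).trans ?_
  rw [Finset.sum_add_distrib, Finset.sum_add_distrib, ← Finset.mul_sum]
  have := mul_le_mul_of_nonneg_left hf (Real.sqrt_nonneg (Real.log n / x))
  linarith [hsq R hR]

/-- For a far shift without wrap-around: the shifted row is at least `e`, so its bias is at most
`√(L/e)`. -/
theorem sum_bias_mul_bias_add_le (hn : 2 ≤ n) {R : Finset ℕ} {y : ℝ} (hy : 0 ≤ y)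
    (hR : ∀ r ∈ R, (r : ℝ) ≤ y) {e : ℕ} (he : 1 ≤ e) :
    ∑ r ∈ R, bias n r * bias n (r + e) ≤
      √(Real.log n / e) * (1 + 2 * √(Real.log n * y)) := by
  refine le_trans ?_ (mul_le_mul_of_nonneg_left (sum_bias_le hn hy hR) (Real.sqrt_nonneg _))
  rw [Finset.mul_sum]
  refine Finset.sum_le_sum fun r _ => ?_
  rw [mul_comm]
  refine mul_le_mul_of_nonneg_right ?_ (bias_nonneg n r)
  exact (bias_antitone hn (Nat.le_add_left e r)).trans (bias_le hn he)

end Bias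


/-! ### Numerical estimates in the parameters `β = √b`, `κ = k`, `A = 1/a`, `u = A^(ε/2)`, `L = ln
n`. -/

theorem lowTau_eq {b : ℝ} (hb : 0 ≤ b) (n k : ℕ) :
    lowTau b n k = (√b * k / 8) ^ 2 * Real.log n := by
  rw [lowTau, div_pow, mul_pow, Real.sq_sqrt hb]
  ring

/-- With both thresholds written as a square times `ln n`, the square roots `√(L x)` and `√(L / x)`
can be evaluated exactly. -/
theorem highTau_eq {a b : ℝ} (ε : ℝ) (ha : 0 < a) (hb : 0 ≤ b) (n k : ℕ) :
    highTau a b ε n k = (√b * k * a⁻¹ * a⁻¹ ^ (ε / 2)) ^ 2 * Real.log n := by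
  have h : a ^ (2 + ε) = a ^ 2 * (a ^ (ε / 2)) ^ 2 := by
    rw [Real.rpow_add ha, ← Real.rpow_natCast (a ^ (ε / 2)) 2, ← Real.rpow_mul ha.le]
    norm_num
  have h1 : 0 < a ^ (ε / 2) := by positivity
  rw [highTau, h, mul_pow, mul_pow, mul_pow, Real.sq_sqrt hb, Real.inv_rpow ha.le]
  field_simp

section Estimates

variable {β κ A u L ε x y : ℝ}

theorem sqrt_mul_sq_mul {z : ℝ} (hz : 0 ≤ z) (hL : 0 ≤ L) : √(L * (z ^ 2 * L)) = z * L := by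
  rw [show L * (z ^ 2 * L) = (z * L) ^ 2 by ring]
  exact Real.sqrt_sq (by positivity)

theorem sqrt_div_sq_mul {z : ℝ} (hz : 0 < z) (hL : 0 < L) : √(L / (z ^ 2 * L)) = 1 / z := by
  rw [show L / (z ^ 2 * L) = (1 / z) ^ 2 by field_simp]
  exact Real.sqrt_sq (by positivity)

/-- The ratio `y / x = (8Au)²` does not depend on `β`, `κ` or `L`. Its logarithm is linear in `u` by
`hAu` and `ln u ≤ u - 1`, so the expectation does not grow with `β`. -/
theorem expected_collisions_le (hL : 1 / 2 ≤ L) (hκ : 2 ≤ κ) (hA : 2 ≤ A)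
    (hu : 1 ≤ u) (hβ : 20 ≤ β) (hAu : Real.log A ≤ 2 / ε * u)
    (hx : x = (β * κ / 8) ^ 2 * L) (hy : y = (β * κ * A * u) ^ 2 * L) :
    √(L / x) * (1 + 2 * √(L * x)) + 2 * (L * (1 / x + Real.log (y / x))) ≤
      L * u * (21 + 8 / ε) := by
  have hβκ : 40 ≤ β * κ := by nlinarith
  have hz : 0 < β * κ / 8 := by positivity
  have hx1 : 1 ≤ x := by
    rw [hx]
    nlinarith
  have hyx : y / x = (8 * A * u) ^ 2 := by
    rw [hx, hy]
    field_simp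
  have hlog : Real.log (y / x) ≤ 2 * (3 + 2 / ε * u + u) := by
    rw [hyx, Real.log_pow, Real.log_mul (by positivity) (by positivity),
      Real.log_mul (by positivity) (by positivity)]
    have h8 : Real.log 8 ≤ 3 := by
      rw [show (8 : ℝ) = 2 ^ 3 by norm_num, Real.log_pow]
      push_cast
      linarith [Real.log_two_lt_d9]
    have := Real.log_le_sub_one_of_pos (show 0 < u by linarith)
    push_cast
    linarith
  have h1 : √(L / x) * (1 + 2 * √(L * x)) ≤ 3 * L := by
    rw [hx, sqrt_mul_sq_mul hz.le (by linarith), sqrt_div_sq_mul hz (by linarith), mul_add,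
      mul_one]
    have e : 1 / (β * κ / 8) * (2 * (β * κ / 8 * L)) = 2 * L := by field_simp
    have e' : 1 / (β * κ / 8) ≤ 1 / 2 := one_div_le_one_div_of_le (by norm_num) (by linarith)
    rw [e]
    linarith
  have h2 : 1 / x ≤ 1 := (div_le_one (by linarith)).2 hx1
  have h3 : L * (1 / x + Real.log (y / x)) ≤ L * (1 + 2 * (3 + 2 / ε * u + u)) :=
    mul_le_mul_of_nonneg_left (by linarith) (by linarith)
  have h4 : L ≤ L * u := le_mul_of_one_le_right (by linarith) hu
  have e : L * u * (21 + 8 / ε) = 21 * (L * u) + 2 * (L * (2 * (2 / ε * u))) := by ring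
  rw [e]
  linarith

/-- Factor `√(L/e) = √(y/e) √(L/y)`; the second root times the expected weight up to `y` is at most
`3L`. -/
theorem expected_collisions_far_le (hε : 0 < ε) (hL : 1 / 2 ≤ L) (hκ : 2 ≤ κ) (hA : 2 ≤ A)
    (hu : 1 ≤ u) (hβ : 20 ≤ β) (hy : y = (β * κ * A * u) ^ 2 * L) {e : ℝ} (he : 0 < e) :
    √(L / e) * (1 + 2 * √(L * y)) ≤ L * u * (21 + 8 / ε) * √(y / e) := by
  have hβκ : 40 ≤ β * κ := by nlinarith
  have hAu : 2 ≤ A * u := by nlinarith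
  have hz : 80 ≤ β * κ * A * u := by
    rw [mul_assoc]
    nlinarith
  have hy0 : 0 < y := by
    rw [hy]
    positivity
  have h1 : √(L / e) = √(y / e) * √(L / y) := by
    rw [← Real.sqrt_mul (by positivity)]
    congr 1
    field_simp
  have h2 : √(L / y) * (1 + 2 * √(L * y)) ≤ 3 * L := by
    rw [hy, sqrt_mul_sq_mul (by linarith) (by linarith),
      sqrt_div_sq_mul (by linarith) (by linarith), mul_add, mul_one]
    have e : 1 / (β * κ * A * u) * (2 * (β * κ * A * u * L)) = 2 * L := by field_simp
    have e' : 1 / (β * κ * A * u) ≤ 1 / 2 := one_div_le_one_div_of_le (by norm_num) (by linarith)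
    rw [e]
    linarith
  have h3 : 3 * L ≤ L * u * (21 + 8 / ε) := by
    have h4 : L ≤ L * u := le_mul_of_one_le_right (by linarith) hu
    have h5 : 0 ≤ L * u * (8 / ε) := by positivity
    linarith
  rw [h1, mul_assoc, mul_comm]
  exact mul_le_mul_of_nonneg_right (h2.trans h3) (Real.sqrt_nonneg _)

/-- The weight up to `y` gives `2zL` with `z = βκAu`. As `√x` is at most `√y / 16`, cutting off the
initial segment costs at most a quarter of it. -/
theorem le_expected_weight (hL : 1 / 2 ≤ L) (hκ : 2 ≤ κ) (hA : 2 ≤ A)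
    (hu : 1 ≤ u) (hβ : 20 ≤ β) (hx : x = (β * κ / 8) ^ 2 * L) (hy : y = (β * κ * A * u) ^ 2 * L)
    {M N : ℝ} (hM : M ≤ x + 1) (hN : y ≤ N) :
    3 / 2 * (β * κ * A * u * L) ≤ 2 * √L * (√(N + L) - √(M + L)) := by
  have hβκ : 40 ≤ β * κ := by nlinarith
  have hAu : 2 ≤ A * u := by nlinarith
  have hz : β * κ * 2 ≤ β * κ * A * u := by
    rw [mul_assoc]
    nlinarith
  set z := β * κ * A * u
  have h1 : z * L ≤ √L * √(N + L) := by
    rw [← Real.sqrt_mul (by linarith), ← sqrt_mul_sq_mul (z := z) (by linarith) (by linarith),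
      ← hy]
    exact Real.sqrt_le_sqrt (mul_le_mul_of_nonneg_left (by linarith) (by linarith))
  have h2 : √L * √(M + L) ≤ z * L / 4 := by
    rw [← Real.sqrt_mul (by linarith)]
    refine Real.sqrt_le_iff.2 ⟨by nlinarith, ?_⟩
    have h3 : L * (M + L) ≤ L * (x + 1 + L) :=
      mul_le_mul_of_nonneg_left (by linarith) (by linarith)
    have h4 : (β * κ * L) ^ 2 * 4 ≤ (z * L) ^ 2 := by
      rw [show (β * κ * L) ^ 2 * 4 = (β * κ * 2 * L) ^ 2 by ring]
      gcongr
    have h5 : (40 * L) ^ 2 ≤ (β * κ * L) ^ 2 := by gcongr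
    have h6 : L * (x + 1 + L) = (β * κ * L) ^ 2 / 64 + L + L ^ 2 := by rw [hx]; ring
    nlinarith
  nlinarith

/-- `8y` is the price of all shifts. Its logarithm and `3 G + 6 L`, where `G = L u (21 + 8/ε)`, are
bounded by multiples of `V = Lu`, which `hβ'` makes at most `βV/6`. -/
theorem mul_exp_sub_le (hε : 0 < ε) (hL : 1 / 2 ≤ L) (hκ : 2 ≤ κ) (hA : 2 ≤ A)
    (hu : 1 ≤ u) (hβ : 20 ≤ β) (hβ' : 82 + 32 / ε + 4 * Real.log β ≤ β / 6)
    (hAu : Real.log A ≤ 2 / ε * u) (hκL : Real.log κ ≤ L) (hy : y = (β * κ * A * u) ^ 2 * L) :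
    8 * y * Real.exp (3 * (L * u * (21 + 8 / ε)) - β * (L * u) / 6) ≤ Real.exp (-(6 * L)) := by
  have hy0 : 0 < y := by
    rw [hy]
    positivity
  have hlog : Real.log (8 * y) = Real.log 8 + (2 * (Real.log β + Real.log κ + Real.log A +
      Real.log u) + Real.log L) := by
    rw [hy, Real.log_mul (by norm_num) (by positivity),
      Real.log_mul (by positivity) (by positivity),
      Real.log_pow, Real.log_mul (by positivity) (by positivity),
      Real.log_mul (by positivity) (by positivity), Real.log_mul (by positivity) (by positivity)]
    norm_num
  have h8 : Real.log 8 ≤ 3 := by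
    rw [show (8 : ℝ) = 2 ^ 3 by norm_num, Real.log_pow]
    push_cast
    linarith [Real.log_two_lt_d9]
  have hlu := Real.log_le_sub_one_of_pos (show 0 < u by linarith)
  have hlL := Real.log_le_sub_one_of_pos (show 0 < L by linarith)
  have hlβ := Real.log_nonneg (show 1 ≤ β by linarith)
  rw [← Real.exp_log (show 0 < 8 * y by positivity), ← Real.exp_add, Real.exp_le_exp, hlog]
  set V := L * u with hV
  have hLV : L ≤ V := le_mul_of_one_le_right (by linarith) hu
  have huV : u ≤ 2 * V := by nlinarith
  have h1V : 1 ≤ 2 * V := by linarith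
  have e1 : Real.log β ≤ 2 * V * Real.log β := le_mul_of_one_le_left hlβ h1V
  have e2 : 2 / ε * u ≤ 2 / ε * (2 * V) := mul_le_mul_of_nonneg_left huV (by positivity)
  have e3 := mul_le_mul_of_nonneg_left hβ' (show 0 ≤ V by linarith)
  have e4 : V * (82 + 32 / ε + 4 * Real.log β) =
      82 * V + 8 * (2 / ε * (2 * V)) + 2 * (2 * V * Real.log β) := by ring
  have e5 : 3 * (V * (21 + 8 / ε)) = 63 * V + 6 * (2 / ε * (2 * V)) := by ring
  rw [e4] at e3
  rw [e5]
  have e6 : V * (β / 6) = β * V / 6 := by ring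
  rw [e6] at e3
  linarith

end Estimates

/-- `ln x ≤ x - 1` at `β/48` and at `48` gives `4 ln β ≤ β/12 + 184`. The other half of `β/6` must
cover `82 + 184 + 32/ε`; multiplying by `12` gives the threshold, with `3192` rounded up. -/
theorem exists_threshold {ε : ℝ} (hε : 0 < ε) :
    ∀ β : ℝ, 3200 + 384 / ε ≤ β → 82 + 32 / ε + 4 * Real.log β ≤ β / 6 := by
  intro β hβ
  have h0 : 0 < 384 / ε := by positivity
  have h1 := Real.log_le_sub_one_of_pos (show 0 < β / 48 by linarith)
  have h2 := Real.log_le_sub_one_of_pos (show (0 : ℝ) < 48 by norm_num)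
  rw [Real.log_div (by linarith) (by norm_num)] at h1
  have h3 : 384 / ε = 12 * (32 / ε) := by ring
  linarith

/-- The bound for the sum over all shifts. -/
theorem sum_shifts_le {y : ℝ} (hy : 1 ≤ y) (t : ℕ) :
    ∑ e ∈ Finset.range t, (if y ≤ (e : ℝ) ∧ (e : ℝ) + y < t then (y / e) ^ 2 else 1) ≤ 8 * y := by
  -- The far shifts contribute at most `2y`; those below `y` and those within `y` of a full turn
  -- contribute at most `y + 1` each.
  have hsplit : ∀ e ∈ Finset.range t,
      (if y ≤ (e : ℝ) ∧ (e : ℝ) + y < t then (y / e) ^ 2 else 1) ≤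
      (if y ≤ (e : ℝ) then (y / e) ^ 2 else 0) + (if (e : ℝ) < y then 1 else 0) +
        (if (t : ℝ) ≤ e + y then 1 else 0) := by
    intro e _
    have : 0 ≤ (y / e) ^ 2 := sq_nonneg _
    by_cases h1 : y ≤ (e : ℝ) <;> by_cases h2 : (e : ℝ) + y < t
    · simp [h1, h2, not_lt.2 h1, not_le.2 h2]
    · simp [h1, h2, not_lt.2 h1, not_lt.1 h2, this]
    · simp [h1, not_le.1 h1, not_le.2 h2]
    · simp [h1, not_le.1 h1, not_lt.1 h2]
  refine (Finset.sum_le_sum hsplit).trans ?_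
  rw [Finset.sum_add_distrib, Finset.sum_add_distrib]
  have hc : 1 ≤ ⌈y⌉₊ := Nat.one_le_ceil_iff.2 (by linarith)
  have hc' : ((⌈y⌉₊ - 1 : ℕ) : ℝ) + 1 = ⌈y⌉₊ := by
    rw [Nat.cast_sub hc]
    simp
  have hyc : (⌈y⌉₊ : ℝ) < y + 1 := Nat.ceil_lt_add_one (by linarith)
  have h1 : ∑ e ∈ Finset.range t, (if y ≤ (e : ℝ) then (y / e) ^ 2 else 0) ≤ 2 * y := by
    rw [← Finset.sum_filter]
    have hsub : (Finset.range t).filter (fun e : ℕ => y ≤ (e : ℝ)) ⊆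
        Finset.Ioo (⌈y⌉₊ - 1) t := by
      intro e he
      obtain ⟨h1, h2⟩ := Finset.mem_filter.1 he
      have := Nat.ceil_le.2 h2
      exact Finset.mem_Ioo.2 ⟨by omega, Finset.mem_range.1 h1⟩
    refine (Finset.sum_le_sum_of_subset_of_nonneg hsub fun _ _ _ => sq_nonneg _).trans ?_
    simp only [div_pow, div_eq_mul_inv (y ^ 2)]
    rw [← Finset.mul_sum]
    have := sum_Ioo_inv_sq_le (α := ℝ) (⌈y⌉₊ - 1) t
    rw [hc'] at this
    have h2 : (2 : ℝ) / ⌈y⌉₊ ≤ 2 / y :=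
      div_le_div_of_nonneg_left (by norm_num) (by linarith) (Nat.le_ceil y)
    calc _ ≤ y ^ 2 * (2 / y) := mul_le_mul_of_nonneg_left (this.trans h2) (sq_nonneg y)
      _ = 2 * y := by field_simp
  have h2 : ∑ e ∈ Finset.range t, (if (e : ℝ) < y then (1 : ℝ) else 0) ≤ y + 1 := by
    rw [← Finset.sum_filter, Finset.sum_const, nsmul_eq_mul, mul_one]
    refine le_trans (Nat.cast_le.2 (Finset.card_le_card (t := Finset.range ⌈y⌉₊) fun e he => ?_)) ?_
    · exact Finset.mem_range.2 (Nat.lt_ceil.2 (Finset.mem_filter.1 he).2)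
    · rw [Finset.card_range]
      exact hyc.le
  have h3 : ∑ e ∈ Finset.range t, (if (t : ℝ) ≤ e + y then (1 : ℝ) else 0) ≤ y + 1 := by
    rw [← Finset.sum_filter, Finset.sum_const, nsmul_eq_mul, mul_one]
    refine le_trans (Nat.cast_le.2 (Finset.card_le_card (t := Finset.Ico (t - ⌈y⌉₊) t)
      fun e he => ?_)) ?_
    · obtain ⟨h1, h2⟩ := Finset.mem_filter.1 he
      have h3 : (t : ℝ) ≤ (e + ⌈y⌉₊ : ℕ) := by
        push_cast
        linarith [Nat.le_ceil y]
      have h4 : t ≤ e + ⌈y⌉₊ := by exact_mod_cast h3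
      exact Finset.mem_Ico.2 ⟨by omega, Finset.mem_range.1 h1⟩
    · rw [Nat.card_Ico]
      refine le_trans (Nat.cast_le.2 (show t - (t - ⌈y⌉₊) ≤ ⌈y⌉₊ by omega)) hyc.le
  linarith

end CodeAlg

/-! ### Tail bounds for the weights and the collisions of random columns. -/

namespace CodeAlg
open RAM ProbabilityTheory

open Classical in
/-- The positions between `x` and `y`. -/
noncomputable def window (t : ℕ) (x y : ℝ) : Finset ℕ :=
  (Finset.range t).filter fun r => x ≤ r ∧ (r : ℝ) ≤ y

open Classical in
/-- The positions up to `x`. -/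
noncomputable def initialWindow (t : ℕ) (x : ℝ) : Finset ℕ :=
  (Finset.range t).filter fun r => (r : ℝ) ≤ x

/-- The position to which position `r` is moved by the `e`-th cyclic shift. -/
def shiftPos (t e r : ℕ) : ℕ := if r < t then (r + e) % t else r

/-- Keeping rows from `t` on fixed makes the shift injective on all of `ℕ`, so collision events
indexed by every natural number form one independent family. -/
theorem shiftPos_injective (t e : ℕ) : Function.Injective (shiftPos t e) := by
  intro r s h
  simp only [shiftPos] at h
  have hmod (x : ℕ) (hx : x < t) : (x + e) % t < t := Nat.mod_lt _ (by omega)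
  split_ifs at h with h1 h2 h2
  · have h3 : r ≡ s [MOD t] := Nat.ModEq.add_right_cancel' e h
    rwa [Nat.ModEq, Nat.mod_eq_of_lt h1, Nat.mod_eq_of_lt h2] at h3
  · have := hmod r h1
    omega
  · have := hmod s h2
    omega
  · exact h

/-- The event that the bit in row `r` and column `j` is set. -/
def bitEvent (n pos j r : ℕ) : Set (ℕ → unitInterval) := heads (pos + r * n + j) (bias n r)

/-- The event that row `r` of column `j` collides with column `j'` shifted by `e`. -/
def collEvent (n t pos j j' e r : ℕ) : Set (ℕ → unitInterval) :=
  bitEvent n pos j r ∩ bitEvent n pos j' (shiftPos t e r)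

section

variable {n t pos j j' e : ℕ}

theorem pos_add_injective (hn : 0 < n) (pos j : ℕ) :
    Function.Injective fun r => pos + r * n + j := fun r s h =>
  Nat.eq_of_mul_eq_mul_right hn (by simp only at h; omega)

theorem iIndepSet_bitEvent (hn : 0 < n) : iIndepSet (bitEvent n pos j) coins :=
  iIndepSet_heads (pos_add_injective hn pos j) _

theorem real_bitEvent (hn : 2 ≤ n) (r : ℕ) : coins.real (bitEvent n pos j r) = bias n r :=
  coins_real_heads _ (bias_nonneg n r) (bias_le_one hn r)

theorem measurableSet_bitEvent (r : ℕ) : MeasurableSet (bitEvent n pos j r) :=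
  measurableSet_heads _ _

theorem measurableSet_collEvent (r : ℕ) : MeasurableSet (collEvent n t pos j j' e r) :=
  (measurableSet_bitEvent _).inter (measurableSet_bitEvent _)

/-- Coins of different columns have different residues modulo `n` after subtracting `pos`. -/
theorem collEvent_indices_injective (hj : j < n) (hj' : j' < n) (hne : j ≠ j') :
    Function.Injective (Sum.elim (fun r => pos + r * n + j)
      (fun r => pos + shiftPos t e r * n + j')) := by
  have hn : 0 < n := by omega
  refine (pos_add_injective hn pos j).sumElim
    ((pos_add_injective hn pos j').comp (shiftPos_injective t e)) fun r s h => hne ?_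
  have h1 : j + n * r = j' + n * shiftPos t e s := by
    rw [mul_comm n, mul_comm n]
    omega
  have h2 := congrArg (· % n) h1
  simpa [Nat.mod_eq_of_lt hj, Nat.mod_eq_of_lt hj'] using h2

theorem iIndepSet_collEvent (hj : j < n) (hj' : j' < n) (hne : j ≠ j') :
    iIndepSet (collEvent n t pos j j' e) coins :=
  (iIndepSet_heads_inter_heads (collEvent_indices_injective hj hj' hne) (bias n)
    (fun r => bias n (shiftPos t e r))).1

theorem real_collEvent (hn : 2 ≤ n) (hj : j < n) (hj' : j' < n) (hne : j ≠ j') (r : ℕ) :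
    coins.real (collEvent n t pos j j' e r) = bias n r * bias n (shiftPos t e r) := by
  have h := (iIndepSet_heads_inter_heads
    (collEvent_indices_injective (pos := pos) (t := t) (e := e) hj hj' hne) (bias n)
    (fun r => bias n (shiftPos t e r))).2 r
  rw [measureReal_def, show coins (collEvent n t pos j j' e r) = _ from h, ENNReal.toReal_mul]
  exact congrArg₂ _ (real_bitEvent hn r) (real_bitEvent hn _)

theorem upperCount_genBit (ω : ℕ → unitInterval) (x : ℝ) :
    (upperCount (genBit n ω pos) x j t : ℝ) =
      eventCount (bitEvent n pos j) (initialWindow t x) ω := by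
  classical
  rw [eventCount_eq_card, upperCount, initialWindow, Finset.filter_filter]
  congr 2
  ext r
  simp only [Finset.mem_filter]
  rw [genBit_eq_true, bitEvent, and_comm (a := (r : ℝ) ≤ x)]

theorem lowerCount_genBit (ω : ℕ → unitInterval) (x y : ℝ) :
    (lowerCount (genBit n ω pos) x y j t : ℝ) =
      eventCount (bitEvent n pos j) (window t x y) ω := by
  classical
  rw [eventCount_eq_card, lowerCount, window, Finset.filter_filter]
  congr 2
  ext r
  simp only [Finset.mem_filter]
  rw [genBit_eq_true, bitEvent, and_comm (a := x ≤ (r : ℝ) ∧ (r : ℝ) ≤ y)]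

/-- The slipped vector is the OR of three shifts. Each is counted separately because its collision
events are independent, which fails for their union. -/
theorem collCount_genBit_le (ω : ℕ → unitInterval) (x y : ℝ) (i : ℕ) :
    (collCount (genBit n ω pos) t x y j j' i t : ℝ) ≤
      eventCount (collEvent n t pos j j' ((i + (t - 1)) % t)) (window t x y) ω +
      eventCount (collEvent n t pos j j' (i % t)) (window t x y) ω +
      eventCount (collEvent n t pos j j' ((i + 1) % t)) (window t x y) ω := by
  classical
  have hmem {e r : ℕ} (hr : r < t) (h1 : genBit n ω pos r j = true)
      (h2 : genBit n ω pos ((r + e) % t) j' = true) :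
      ω ∈ collEvent n t pos j j' (e % t) r := by
    refine ⟨genBit_eq_true.1 h1, ?_⟩
    have : shiftPos t (e % t) r = (r + e) % t := by
      rw [shiftPos, if_pos hr, Nat.add_mod_mod]
    rw [this]
    exact genBit_eq_true.1 h2
  rw [eventCount_eq_card, eventCount_eq_card, eventCount_eq_card, collCount, ← Nat.cast_add,
    ← Nat.cast_add, Nat.cast_le]
  refine le_trans (Finset.card_le_card fun r hr => ?_) ((Finset.card_union_le _ _).trans
    (Nat.add_le_add_right (Finset.card_union_le _ _) _))
  obtain ⟨h0, h1, h2, h3⟩ := Finset.mem_filter.1 hr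
  have hw : r ∈ window t x y := Finset.mem_filter.2 ⟨h0, h2⟩
  have ht := Finset.mem_range.1 h0
  rcases h3 with (h3 | h3) | h3
  · rw [add_assoc] at h3
    exact Finset.mem_union_left _ (Finset.mem_union_left _
      (Finset.mem_filter.2 ⟨hw, hmem ht h1 h3⟩))
  · exact Finset.mem_union_left _ (Finset.mem_union_right _
      (Finset.mem_filter.2 ⟨hw, hmem ht h1 h3⟩))
  · rw [add_assoc] at h3
    exact Finset.mem_union_right _ (Finset.mem_filter.2 ⟨hw, hmem ht h1 h3⟩)

end

section Tails

variable {n t pos j j' : ℕ} {β κ A u ε x y : ℝ}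

theorem upper_tail_le (hn : 2 ≤ n) (hκ : 2 ≤ κ) (hβ : 20 ≤ β)
    (hx : x = (β * κ / 8) ^ 2 * Real.log n) :
    coins.real {ω | 3 / 4 * (β * κ * Real.log n) ≤
      eventCount (bitEvent n pos j) (initialWindow t x) ω} ≤ Real.exp (-(6 * Real.log n)) := by
  have hL := half_le_log hn
  set L := Real.log n
  have hx0 : 0 ≤ x := by rw [hx]; positivity
  have hm : ∑ r ∈ initialWindow t x, coins.real (bitEvent n pos j r) ≤ 1 + β * κ * L / 4 := by
    simp only [real_bitEvent hn]
    refine (sum_bias_le hn hx0 fun r hr => (Finset.mem_filter.1 hr).2).trans_eq ?_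
    rw [hx, sqrt_mul_sq_mul (by positivity) (by linarith)]
    ring
  refine (measure_le_eventCount_le (iIndepSet_bitEvent (by omega)) measurableSet_bitEvent _ _
    zero_le_one hm).trans (Real.exp_le_exp.2 ?_)
  have he : Real.exp 1 - 1 ≤ 2 := by linarith [Real.exp_one_lt_d9]
  have hS : 0 < β * κ * L := by positivity
  have h1 : (Real.exp 1 - 1) * (1 + β * κ * L / 4) ≤ 2 * (1 + β * κ * L / 4) :=
    mul_le_mul_of_nonneg_right he (by linarith)
  -- With `S = βκL` the exponent is at most `2 - S/4 ≤ 2 - 10 L`, and this is at most `-6 L` since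
  -- `L ≥ 1/2`.
  have h2 : 40 * L ≤ β * κ * L := mul_le_mul_of_nonneg_right (by nlinarith) (by linarith)
  linarith

theorem lower_tail_le (hn : 2 ≤ n) (hκ : 2 ≤ κ) (hA : 2 ≤ A) (hu : 1 ≤ u) (hβ : 20 ≤ β)
    (hx : x = (β * κ / 8) ^ 2 * Real.log n) (hy : y = (β * κ * A * u) ^ 2 * Real.log n)
    (hyt : y ≤ t) :
    coins.real {ω | eventCount (bitEvent n pos j) (window t x y) ω ≤
      3 / 4 * (β * κ * A * u * Real.log n)} ≤ Real.exp (-(6 * Real.log n)) := by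
  have hL := half_le_log hn
  have hβκ : 40 ≤ β * κ := by nlinarith
  have hAu : 2 ≤ A * u := by nlinarith
  have hz : 80 ≤ β * κ * A * u := by
    rw [mul_assoc]
    nlinarith
  have hx0 : 0 ≤ x := by rw [hx]; positivity
  have hxy : x ≤ y := by
    rw [hx, hy]
    gcongr
    rw [mul_assoc]
    nlinarith
  have hm : 3 / 2 * (β * κ * A * u * Real.log n) ≤
      ∑ r ∈ window t x y, coins.real (bitEvent n pos j r) := by
    simp only [real_bitEvent hn]
    have hM : (⌈x⌉₊ : ℝ) ≤ x + 1 := (Nat.ceil_lt_add_one hx0).le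
    refine (le_expected_weight hL hκ hA hu hβ hx hy hM (Nat.le_ceil y)).trans
      ((le_sum_Ico_bias hn (Nat.ceil_mono hxy)).trans ?_)
    -- Because `y ≤ t`, the window is not truncated by the end of the column.
    refine Finset.sum_le_sum_of_subset_of_nonneg (fun r hr => ?_) fun r _ _ => bias_nonneg n r
    obtain ⟨h1, h2⟩ := Finset.mem_Ico.1 hr
    have h3 := Nat.lt_ceil.1 h2
    refine Finset.mem_filter.2 ⟨Finset.mem_range.2 ?_, Nat.ceil_le.1 h1, h3.le⟩
    exact_mod_cast h3.trans_le hyt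
  refine (measure_eventCount_le_le (l := -1) (iIndepSet_bitEvent (by omega))
    measurableSet_bitEvent _ _ (by norm_num) hm).trans (Real.exp_le_exp.2 ?_)
  have he : Real.exp (-1) ≤ 3 / 8 := by
    rw [Real.exp_neg, inv_le_comm₀ (Real.exp_pos 1) (by norm_num)]
    linarith [Real.exp_one_gt_d9]
  set L := Real.log n
  have hW : 80 * L ≤ β * κ * A * u * L := mul_le_mul_of_nonneg_right hz (by linarith)
  have h1 : (Real.exp (-1) - 1) * (3 / 2 * (β * κ * A * u * L)) ≤
      (3 / 8 - 1) * (3 / 2 * (β * κ * A * u * L)) :=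
    mul_le_mul_of_nonneg_right (by linarith) (by linarith)
  linarith

/-- The tail of the number of collisions if its expectation is at most `G * ρ`. -/
theorem collision_tail_le (hn : 2 ≤ n) (hj : j < n) (hj' : j' < n) (hne : j ≠ j') {e : ℕ}
    {R : Finset ℕ} {G ρ θ : ℝ} (hG : 0 ≤ G) (hρ : 0 < ρ) (hρ1 : ρ ≤ 1) (hθ : 4 ≤ θ)
    (hm : ∑ r ∈ R, bias n r * bias n (shiftPos t e r) ≤ G * ρ) :
    coins.real {ω | θ ≤ eventCount (collEvent n t pos j j' e) R ω} ≤
      Real.exp (3 * G - θ) * ρ ^ 4 := by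
  have hlog : Real.log ρ ≤ 0 := Real.log_nonpos hρ.le hρ1
  have hm' : ∑ r ∈ R, coins.real (collEvent n t pos j j' e r) ≤ G * ρ := by
    simpa only [real_collEvent hn hj hj' hne] using hm
  -- The tilt `exp l = e/ρ` cancels the small factor `ρ` of the mean, leaving at most `3 G`, while
  -- `-l θ` gains `ρ^θ ≤ ρ^4`.
  refine (measure_le_eventCount_le (l := 1 - Real.log ρ) (iIndepSet_collEvent hj hj' hne)
    measurableSet_collEvent _ _ (by linarith) hm').trans ?_
  have h4 : ρ ^ 4 = Real.exp (4 * Real.log ρ) := by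
    rw [mul_comm, Real.exp_mul, Real.exp_log hρ]
    norm_cast
  rw [h4, ← Real.exp_add, Real.exp_le_exp, Real.exp_sub, Real.exp_log hρ]
  have h1 : (Real.exp 1 / ρ - 1) * (G * ρ) = (Real.exp 1 - ρ) * G := by field_simp
  have h2 : (Real.exp 1 - ρ) * G ≤ 3 * G :=
    mul_le_mul_of_nonneg_right (by linarith [Real.exp_one_lt_d9]) hG
  have h3 : θ * Real.log ρ ≤ 4 * Real.log ρ := mul_le_mul_of_nonpos_right hθ hlog
  rw [h1]
  linarith

/-- A shift with `y ≤ e < t - y` does not wrap around in the window and is treated with `ρ =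
√(y/e)`; all others use `ρ = 1`. The bound is independent of `t`. -/
theorem sum_collision_tail_le (hn : 2 ≤ n) (hj : j < n) (hj' : j' < n) (hne : j ≠ j')
    (hε : 0 < ε) (hκ : 2 ≤ κ) (hA : 2 ≤ A) (hu : 1 ≤ u) (hβ : 48 ≤ β)
    (hβ' : 82 + 32 / ε + 4 * Real.log β ≤ β / 6)
    (hAu : Real.log A ≤ 2 / ε * u) (hκn : κ ≤ n)
    (hx : x = (β * κ / 8) ^ 2 * Real.log n) (hy : y = (β * κ * A * u) ^ 2 * Real.log n) :
    ∑ e ∈ Finset.range t, coins.real {ω | β * (Real.log n * u) / 6 ≤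
      eventCount (collEvent n t pos j j' e) (window t x y) ω} ≤
      Real.exp (-(6 * Real.log n)) := by
  have hL := half_le_log hn
  have hβκ : 96 ≤ β * κ := by nlinarith
  have hAu' : 2 ≤ A * u := by nlinarith
  have hz : 80 ≤ β * κ * A * u := by
    rw [mul_assoc]
    nlinarith
  have hx1 : 1 ≤ x := by
    rw [hx]
    nlinarith
  have hxy : x ≤ y := by
    rw [hx, hy]
    gcongr
    rw [mul_assoc]
    nlinarith
  have hy1 := hx1.trans hxy
  have hκL : Real.log κ ≤ Real.log n := Real.log_le_log (by linarith) hκn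
  set L := Real.log n with hLdef
  set G := L * u * (21 + 8 / ε) with hG
  have hG0 : 0 ≤ G := by positivity
  have hLu : 1 / 2 ≤ L * u := hL.trans (le_mul_of_one_le_right (by linarith) hu)
  have hθ : 4 ≤ β * (L * u) / 6 := by nlinarith
  have hR : ∀ r ∈ window t x y, r < t ∧ x ≤ (r : ℝ) ∧ (r : ℝ) ≤ y := fun r hr =>
    ⟨Finset.mem_range.1 (Finset.mem_filter.1 hr).1, (Finset.mem_filter.1 hr).2⟩
  refine le_trans ?_ (mul_exp_sub_le hε hL hκ hA hu (by linarith) hβ' hAu hκL hy)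
  rw [mul_comm (8 * y)]
  refine le_trans ?_ (mul_le_mul_of_nonneg_left (sum_shifts_le hy1 t) (Real.exp_pos _).le)
  rw [Finset.mul_sum]
  refine Finset.sum_le_sum fun e _ => ?_
  split_ifs with he
  · have he0 : (0 : ℝ) < e := by linarith
    have he1 : 1 ≤ e := by exact_mod_cast he0
    have hρ : √(y / e) ^ 4 = (y / e) ^ 2 := by
      rw [show √(y / e) ^ 4 = (√(y / e) ^ 2) ^ 2 by ring, Real.sq_sqrt (by positivity)]
    rw [← hρ]
    refine collision_tail_le hn hj hj' hne hG0 (by positivity)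
      (Real.sqrt_le_one.2 ((div_le_one he0).2 he.1)) hθ ?_
    refine le_trans (Finset.sum_le_sum fun r hr => ?_) ((sum_bias_mul_bias_add_le hn (by linarith)
      (fun r hr => (hR r hr).2.2) he1).trans
      (expected_collisions_far_le hε hL hκ hA hu (by linarith) hy he0))
    obtain ⟨h1, h2, h3⟩ := hR r hr
    have h4 : r + e < t := by
      have : ((r + e : ℕ) : ℝ) < t := by
        push_cast
        linarith [he.2]
      exact_mod_cast this
    rw [shiftPos, if_pos h1, Nat.mod_eq_of_lt h4]
  · refine (collision_tail_le hn hj hj' hne hG0 one_pos le_rfl hθ ?_).trans_eq (by rw [one_pow])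
    rw [mul_one]
    exact (sum_bias_mul_bias_le hn hx1 hxy (fun r hr => (hR r hr).2)
      (shiftPos_injective t e).injOn).trans
      (expected_collisions_le hL hκ hA hu (by linarith) hAu hx hy)

end Tails

/-! ### The union bound for a single round. -/

/-- As `a A = 1`, `a w` exceeds `3/4 βkLu`. Three shifts give fewer than `βLu/2` collisions per
column, and `(k - 1) βLu/2 ≤ 3/4 βkLu - 1`. -/
theorem good_of_bounds {n t pos j j' i k : ℕ} {β A u a x y L : ℝ} {ω : ℕ → unitInterval}
    (hk : 2 ≤ k) (ha : a * A = 1) (ha0 : 0 < a) (hu : 1 ≤ u) (hβ : 20 ≤ β) (hL : 1 / 2 ≤ L)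
    (hi : i < t)
    (h1 : eventCount (bitEvent n pos j) (initialWindow t x) ω < 3 / 4 * (β * k * L))
    (h2 : 3 / 4 * (β * k * A * u * L) < eventCount (bitEvent n pos j) (window t x y) ω)
    (h3 : ∀ e < t, eventCount (collEvent n t pos j j' e) (window t x y) ω < β * (L * u) / 6) :
    Good (genBit n ω pos) t a x y k j j' i := by
  have hk' : (2 : ℝ) ≤ k := by exact_mod_cast hk
  have haw : 3 / 4 * (β * k * L * u) ≤
      a * eventCount (bitEvent n pos j) (window t x y) ω := by
    calc 3 / 4 * (β * k * L * u) = a * A * (3 / 4 * (β * k * L * u)) := by rw [ha, one_mul]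
      _ = a * (3 / 4 * (β * k * A * u * L)) := by ring
      _ ≤ _ := mul_le_mul_of_nonneg_left h2.le ha0.le
  have hS : β * k * L ≤ β * k * L * u := le_mul_of_one_le_right (by positivity) hu
  constructor
  · rw [upperCount_genBit, lowerCount_genBit]
    linarith
  · have hc : (collCount (genBit n ω pos) t x y j j' i t : ℝ) ≤
        (a * lowerCount (genBit n ω pos) x y j t - 1) / ((k : ℝ) - 1) := by
      rw [lowerCount_genBit, le_div_iff₀ (by linarith)]
      have ht : 0 < t := by omega
      have hcc := collCount_genBit_le (n := n) (t := t) (pos := pos) (j := j) (j' := j') ω x y i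
      have e1 := h3 _ (Nat.mod_lt (i + (t - 1)) ht)
      have e2 := h3 _ (Nat.mod_lt i ht)
      have e3 := h3 _ (Nat.mod_lt (i + 1) ht)
      have h4 : (collCount (genBit n ω pos) t x y j j' i t : ℝ) * ((k : ℝ) - 1) ≤
          β * (L * u) / 2 * ((k : ℝ) - 1) :=
        mul_le_mul_of_nonneg_right (by linarith) (by linarith)
      have h5 : 20 ≤ β * k * L * u := by
        have : 40 ≤ β * k := by nlinarith
        nlinarith
      have h6 : 0 ≤ β * (L * u) := by positivity
      nlinarith
    have : (collCount (genBit n ω pos) t x y j j' i t : ℤ) ≤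
        ⌊(a * lowerCount (genBit n ω pos) x y j t - 1) / ((k : ℝ) - 1)⌋ :=
      Int.le_floor.2 (by exact_mod_cast hc)
    exact_mod_cast this

theorem highTau_mono {a b : ℝ} (ε : ℝ) (ha : 0 < a) (hb : 0 ≤ b) (n : ℕ) :
    Monotone (highTau a b ε n) := by
  intro k l h
  have h' : (k : ℝ) ≤ l := by exact_mod_cast h
  have := Real.log_natCast_nonneg n
  unfold highTau
  gcongr

/-- A round fails with probability at most `1 / n²`. -/
theorem real_not_roundPasses_le {n t Δ : ℕ} {a b ε : ℝ} (hn : 2 ≤ n) (hε : 0 < ε) (ha : 0 < a)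
    (ha2 : a ≤ 1 / 2) (hb : (3200 + 384 / ε) ^ 2 ≤ b) (hΔn : Δ ≤ n)
    (hΔt : highTau a b ε n Δ ≤ t) (m : ℕ) :
    coins.real {ω | ¬ RoundPasses n t Δ a b ε ω m} ≤ ((n : ℝ) ^ 2)⁻¹ := by
  have hL := half_le_log hn
  have hn' : (2 : ℝ) ≤ n := by exact_mod_cast hn
  have h384 : 0 < 384 / ε := by positivity
  have hb0 : 0 ≤ b := (sq_nonneg _).trans hb
  have hβ : 3200 + 384 / ε ≤ √b := Real.le_sqrt_of_sq_le hb
  have hβ' := exists_threshold hε _ hβ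
  have hA : 2 ≤ a⁻¹ := by
    rw [le_inv_comm₀ (by norm_num) ha]
    linarith
  have hu : 1 ≤ a⁻¹ ^ (ε / 2) := Real.one_le_rpow (by linarith) (by linarith)
  have hAu : Real.log a⁻¹ ≤ 2 / ε * a⁻¹ ^ (ε / 2) := by
    -- The inequality `ln A ≤ A^s / s` with `s = ε/2`, the only place where `ln A` is traded for a
    -- power.
    refine (Real.log_le_rpow_div (ε := ε / 2) (by linarith) (by linarith)).trans_eq ?_
    field_simp
  set pos := m * (t * n)
  set A := a⁻¹
  set u := A ^ (ε / 2)
  set β := √b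
  set L := Real.log n with hLdef
  let x (k : ℕ) : ℝ := lowTau b n k
  let y (k : ℕ) : ℝ := highTau a b ε n k
  have hx (k : ℕ) : x k = (β * k / 8) ^ 2 * L := lowTau_eq hb0 n k
  have hy (k : ℕ) : y k = (β * k * A * u) ^ 2 * L := highTau_eq ε ha hb0 n k
  let E₁ (k j : ℕ) : Set (ℕ → unitInterval) := {ω | 3 / 4 * (β * k * L) ≤
    eventCount (bitEvent n pos j) (initialWindow t (x k)) ω}
  let E₂ (k j : ℕ) : Set (ℕ → unitInterval) := {ω |
    eventCount (bitEvent n pos j) (window t (x k) (y k)) ω ≤ 3 / 4 * (β * k * A * u * L)}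
  let E₃ (k j j' e : ℕ) : Set (ℕ → unitInterval) := {ω | β * (L * u) / 6 ≤
    eventCount (collEvent n t pos j j' e) (window t (x k) (y k)) ω}
  have hsub : {ω | ¬ RoundPasses n t Δ a b ε ω m} ⊆
      ⋃ k ∈ Finset.Icc 2 Δ, ⋃ j ∈ Finset.range n, (E₁ k j ∪ E₂ k j) ∪
        ⋃ j' ∈ (Finset.range n).erase j, ⋃ e ∈ Finset.range t, E₃ k j j' e := by
    intro ω hω
    by_contra hnot
    refine hω fun k hk hk1 j hj j' hj' hne i hi => ?_
    simp only [Set.mem_iUnion, Set.mem_union, Finset.mem_Icc, Finset.mem_range, Finset.mem_erase,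
      exists_prop, not_exists, not_and, not_or] at hnot
    obtain ⟨⟨h1, h2⟩, h3⟩ := hnot k ⟨hk1, Nat.lt_succ_iff.1 hk⟩ j hj
    exact good_of_bounds hk1 (mul_inv_cancel₀ ha.ne') ha hu (by linarith) hL hi (not_le.1 h1)
      (not_le.1 h2) fun e he => not_le.1 (h3 j' ⟨hne.symm, hj'⟩ e he)
  set δ := Real.exp (-(6 * L)) with hδ
  have hδ0 : 0 < δ := Real.exp_pos _
  have hkj : ∀ k ∈ Finset.Icc 2 Δ, ∀ j ∈ Finset.range n, coins.real ((E₁ k j ∪ E₂ k j) ∪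
        ⋃ j' ∈ (Finset.range n).erase j, ⋃ e ∈ Finset.range t, E₃ k j j' e) ≤ (n + 2) * δ := by
    intro k hk j hj
    obtain ⟨hk2, hkΔ⟩ := Finset.mem_Icc.1 hk
    have hk2' : (2 : ℝ) ≤ k := by exact_mod_cast hk2
    have hkn : (k : ℝ) ≤ n := by exact_mod_cast hkΔ.trans hΔn
    have hyt : y k ≤ t := (highTau_mono ε ha hb0 n hkΔ).trans hΔt
    have h1 : coins.real (E₁ k j) ≤ δ := upper_tail_le hn hk2' (by linarith) (hx k)
    have h2 : coins.real (E₂ k j) ≤ δ :=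
      lower_tail_le hn hk2' hA hu (by linarith) (hx k) (hy k) hyt
    have h3 : coins.real (⋃ j' ∈ (Finset.range n).erase j, ⋃ e ∈ Finset.range t, E₃ k j j' e) ≤
        n * δ := by
      refine (measureReal_biUnion_finset_le _ _).trans ((Finset.sum_le_card_nsmul _ _ δ
        fun j' hj' => ?_).trans ?_)
      · obtain ⟨hne, hj'⟩ := Finset.mem_erase.1 hj'
        exact (measureReal_biUnion_finset_le _ _).trans (sum_collision_tail_le hn
          (Finset.mem_range.1 hj) (Finset.mem_range.1 hj') hne.symm hε hk2' hA hu (by linarith)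
          hβ' hAu hkn (hx k) (hy k))
      · rw [nsmul_eq_mul]
        refine mul_le_mul_of_nonneg_right (Nat.cast_le.2 ?_) hδ0.le
        exact (Finset.card_le_card (Finset.erase_subset _ _)).trans_eq (Finset.card_range n)
    have h4 := measureReal_union_le (μ := coins) (E₁ k j) (E₂ k j)
    have h5 := measureReal_union_le (μ := coins) (E₁ k j ∪ E₂ k j)
      (⋃ j' ∈ (Finset.range n).erase j, ⋃ e ∈ Finset.range t, E₃ k j j' e)
    linarith
  -- Fewer than `n` values of `k`, then `n` columns `j`; with `δ = n⁻⁶` and `n + 2 ≤ n²` this is at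
  -- most `n⁻²`.
  have htot : coins.real {ω | ¬ RoundPasses n t Δ a b ε ω m} ≤ n * (n * ((n + 2) * δ)) := by
    refine (measureReal_mono hsub (measure_ne_top _ _)).trans
      ((measureReal_biUnion_finset_le _ _).trans ((Finset.sum_le_card_nsmul _ _
        (n * ((n + 2) * δ)) fun k hk => ?_).trans ?_))
    · refine (measureReal_biUnion_finset_le _ _).trans
        ((Finset.sum_le_card_nsmul _ _ _ (hkj k hk)).trans_eq ?_)
      rw [nsmul_eq_mul, Finset.card_range]
    · rw [nsmul_eq_mul]
      refine mul_le_mul_of_nonneg_right (Nat.cast_le.2 ?_) (by positivity)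
      rw [Nat.card_Icc]
      omega
  have hδn : δ = ((n : ℝ) ^ 6)⁻¹ := by
    rw [hδ, Real.exp_neg, mul_comm, Real.exp_mul, hLdef, Real.exp_log (by linarith)]
    norm_cast
  refine htot.trans ?_
  rw [hδn, ← div_eq_mul_inv, inv_eq_one_div, ← mul_div_assoc, ← mul_div_assoc,
    div_le_div_iff₀ (by positivity) (by positivity)]
  have h1 : (n : ℝ) + 2 ≤ n ^ 2 := by nlinarith
  have h2 : (n : ℝ) * (n * (n + 2)) * n ^ 2 = n ^ 4 * (n + 2) := by ring
  have h3 : (1 : ℝ) * n ^ 6 = n ^ 4 * n ^ 2 := by ring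
  rw [h2, h3]
  exact mul_le_mul_of_nonneg_left h1 (by positivity)

theorem coins_not_roundPasses_le {n t Δ : ℕ} {a b ε : ℝ} (hn : 2 ≤ n) (hε : 0 < ε) (ha : 0 < a)
    (ha2 : a ≤ 1 / 2) (hb : (3200 + 384 / ε) ^ 2 ≤ b) (hΔn : Δ ≤ n)
    (hΔt : highTau a b ε n Δ ≤ t) (m : ℕ) :
    coins {ω | ¬ RoundPasses n t Δ a b ε ω m} ≤ ((n : ℝ≥0∞) ^ 2)⁻¹ := by
  have hn0 : (0 : ℝ) < n := by
    have : 0 < n := by omega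
    exact_mod_cast this
  rw [← ofReal_measureReal]
  refine (ENNReal.ofReal_le_ofReal
    (real_not_roundPasses_le hn hε ha ha2 hb hΔn hΔt m)).trans_eq ?_
  rw [ENNReal.ofReal_inv_of_pos (by positivity), ENNReal.ofReal_pow hn0.le, ENNReal.ofReal_natCast]

/-! ### Conclusion: correctness, tail and expectation of the running time. -/

theorem isURSC_of_result {n t Δ : ℕ} {α ε c : ℝ} (hα : 0 < α) (hn : 2 ≤ n) (hc : 0 < c)
    (hΔ : IsGreatest {d : ℕ | d ≤ n ∧ highTau (α / 2) (c / 2 ^ (2 + ε)) ε n d ≤ t} Δ)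
    {ω : ℕ → unitInterval} {s : State} (h : algorithm.result ω (start n t α ε c) = some s) :
    IsURSC (outputMatrix t n s) α (elongation c α ε) Δ := by
  obtain ⟨m, hm, hs⟩ := exists_of_result_eq_some hΔ h
  have hM : outputMatrix t n s =
      Matrix.of fun (r : Fin t) (j : Fin n) => genBit n ω (m * (t * n)) r j := by
    ext r j
    exact hs r r.2 j j.2
  have hL := half_le_log hn
  have hpos : ∀ k : ℕ, 1 ≤ k → 0 < highTau (α / 2) (c / 2 ^ (2 + ε)) ε n k := by
    intro k hk
    have : (0 : ℝ) < k := by exact_mod_cast hk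
    unfold highTau
    positivity
  rw [hM]
  refine isURSC_of_passes hα (fun j _ => ?_) (elongation_eq_highTau hα n) ?_ (fun h1 => ?_) hm
  -- Row `0` has bias `1`, so its coins show `1` for every `ω`, not only almost surely.
  · rw [genBit_eq_true, heads, Set.mem_ofPred_eq, bias_zero]
    exact (ω _).2.2
  · rw [elongation_eq_highTau hα]
    exact (hpos 1 le_rfl).le
  · have := (hpos Δ h1).trans_le hΔ.1.2
    exact_mod_cast this

/-- Failure probability at most `1/2` makes the expected number of rounds at most the geometric sum
`2`. -/
theorem lintegral_runTime_le {n t Δ : ℕ} {α ε c : ℝ}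
    (hΔ : IsGreatest {d : ℕ | d ≤ n ∧ highTau (α / 2) (c / 2 ^ (2 + ε)) ε n d ≤ t} Δ)
    (hp : ∀ m, coins {ω | ¬ RoundPasses n t Δ (α / 2) (c / 2 ^ (2 + ε)) ε ω m} ≤ 2⁻¹) :
    ∫⁻ ω, algorithm.runTime ω (start n t α ε c) ∂coins ≤
      ((setupTime n t Δ + 2 * roundTime n t Δ : ℕ) : ℝ≥0∞) := by
  have hmeas (m : ℕ) : MeasurableSet
      {ω | ∀ i < m, ¬ RoundPasses n t Δ (α / 2) (c / 2 ^ (2 + ε)) ε ω i} := by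
    have : {ω | ∀ i < m, ¬ RoundPasses n t Δ (α / 2) (c / 2 ^ (2 + ε)) ε ω i} =
        ⋂ i ∈ Finset.range m, {ω | RoundPasses n t Δ (α / 2) (c / 2 ^ (2 + ε)) ε ω i}ᶜ := by
      ext ω
      simp
    rw [this]
    exact Finset.measurableSet_biInter _ fun i _ => (measurableSet_roundPasses _ _ _ _ _ _ i).compl
  refine (lintegral_mono (runTime_le_tsum hΔ)).trans ?_
  rw [lintegral_add_left measurable_const, lintegral_const, measure_univ, mul_one,
    lintegral_tsum fun m => (measurable_const.indicator (hmeas m)).aemeasurable, Nat.cast_add,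
    Nat.cast_mul, mul_comm (_ : ℝ≥0∞) (roundTime n t Δ : ℝ≥0∞)]
  gcongr
  simp only [lintegral_indicator_const (hmeas _)]
  rw [ENNReal.tsum_mul_left]
  gcongr
  refine (ENNReal.tsum_le_tsum fun m => coins_forall_not_roundPasses_le hp m).trans_eq ?_
  rw [ENNReal.tsum_geometric, ENNReal.one_sub_inv_two, inv_inv, Nat.cast_ofNat]

end CodeAlg

theorem theorem2 :
    ∃ K : ℕ, ∀ ε : ℝ, 0 < ε → ∃ c₀ : ℝ, 0 < c₀ ∧ ∀ c : ℝ, c₀ ≤ c →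
      ∀ (n t : ℕ) (α : ℝ), 2 ≤ n → 0 < α → α ≤ 1 →
      ∀ Δ : ℕ, IsGreatest {d : ℕ | d ≤ n ∧ elongation c α ε n d ≤ (t : ℝ)} Δ →
        (∀ (ω : ℕ → unitInterval) (s : RAM.State),
          CodeAlg.algorithm.result ω (CodeAlg.start n t α ε c) = some s →
            IsURSC (CodeAlg.outputMatrix t n s) α (elongation c α ε) Δ) ∧
        (∀ m : ℕ,
          RAM.coins {ω | ((m * (K * n ^ 3 * (t + 1) ^ 2) : ℕ) : ℝ≥0∞) <
              CodeAlg.algorithm.runTime ω (CodeAlg.start n t α ε c)} ≤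
            ((n : ℝ≥0∞) ^ (2 * m))⁻¹) ∧
        ∫⁻ ω, CodeAlg.algorithm.runTime ω (CodeAlg.start n t α ε c) ∂(RAM.coins) ≤
          ((K * n ^ 3 * (t + 1) ^ 2 : ℕ) : ℝ≥0∞) := by
  -- `c₀` is chosen so that `b = c / 2^(2+ε)` satisfies `√b ≥ 3200 + 384/ε`. The expectation needs
  -- `K ≥ 113 + 2 * 261`, the tail only `113 + 261`.
  refine ⟨1000, fun ε hε => ⟨(3200 + 384 / ε) ^ 2 * 2 ^ (2 + ε), by positivity,
    fun c hc n t α hn hα hα1 Δ hΔ => ?_⟩⟩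
  have hc0 : 0 < c := lt_of_lt_of_le (by positivity) hc
  have hb : (3200 + 384 / ε) ^ 2 ≤ c / 2 ^ (2 + ε) := (le_div_iff₀ (by positivity)).2 hc
  simp only [CodeAlg.elongation_eq_highTau hα] at hΔ
  have hp := CodeAlg.coins_not_roundPasses_le hn hε (half_pos hα) (by linarith) hb hΔ.1.1 hΔ.1.2
  have hS := CodeAlg.setupTime_le t Δ (show 1 ≤ n by omega)
  have hR := CodeAlg.roundTime_le (t := t) (show 1 ≤ n by omega) hΔ.1.1
  refine ⟨fun ω s hs => CodeAlg.isURSC_of_result hα hn hc0 hΔ hs, fun m => ?_, ?_⟩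
  · refine le_trans (measure_mono fun ω hω => ?_)
      ((CodeAlg.coins_forall_not_roundPasses_le hp m).trans_eq ?_)
    -- A pass in a round `i < m` would keep the time within `m` times the bound; here `m ≥ 1`, so
    -- the setup cost can be charged `m` times.
    · intro i hi hpass
      refine absurd (CodeAlg.runTime_le_of_roundPasses hΔ hpass) (not_le.2 (lt_of_le_of_lt ?_ hω))
      rw [Nat.cast_le, mul_assoc 1000]
      set X := n ^ 3 * (t + 1) ^ 2
      calc CodeAlg.setupTime n t Δ + CodeAlg.roundTime n t Δ * (i + 1)
          ≤ 113 * X * m + 261 * X * m :=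
            add_le_add (hS.trans (Nat.le_mul_of_pos_right _ (by omega))) (Nat.mul_le_mul hR hi)
        _ = m * (374 * X) := by ring
        _ ≤ m * (1000 * X) := Nat.mul_le_mul_left m (Nat.mul_le_mul_right X (by norm_num))
    · rw [← ENNReal.inv_pow, ← pow_mul]
  · refine (CodeAlg.lintegral_runTime_le hΔ fun m => (hp m).trans ?_).trans ?_
    · refine ENNReal.inv_le_inv.2 ?_
      have : 2 ≤ n ^ 2 := by nlinarith
      exact_mod_cast this
    · rw [Nat.cast_le, mul_assoc 1000]
      omega
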